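/- Let $n\ge 1$, let $\mathbb C^n$ carry the inner product $\langle z,w\rangle=\sum_j z_j\overline{w_j}$ and norm $|\cdot|$, let $\mathbb B^n$ be its open unit ball and let $p\in\partial\mathbb B^n$. Write $J_f(p)=(\partial f_j/\partial z_k(p))_{j,k}$, let $T^{(1,0)}_p(\partial\mathbb B^n)=\{\tau\in\mathbb C^n:\langle\tau,p\rangle=0\}$, let $\frac{\partial |f|}{\partial p}$ be the directional derivative of $|f|$ at $p$ in the direction $p$, and let $$\Omega_{\mathbb B^n,p}(z)=-\frac{1-|z|^2}{|1-\langle z,p\rangle|^2},\qquad z\in\mathbb B^n,$$ be the (negative) pluricomplex Poisson kernel. Let $f:\mathbb B^n\to\mathbb B^n$ be a holomorphic mapping that is holomorphic at $p$ (i.e. extends holomorphically to a neighbourhood of $p$) and satisfies $f(p)=p$. Then the directional derivative $\lambda=\frac{\partial|f|}{\partial p}$ exists and is an eigenvalue of $J_f(p)$, and if $\lambda,\mu_2,\dots,\mu_n$ are the eigenvalues of $J_f(p)$ counted with algebraic multiplicity, then: (i) $\displaystyle \lambda=\frac{\partial |f|}{\partial p}\ge\frac{|1-\langle f(0),p\rangle|^2}{1-|f(0)|^2}>0$;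 (ii) $\overline{J_f(p)}^{\,t}\,p=\lambda p$; (iii) $|\mu_j|\le\sqrt\lambda$ for $j=2,\dots,n$; (iv) for each $j=2,\dots,n$ there is $\tau_j\in T^{(1,0)}_p(\partial\mathbb B^n)$ with $|\tau_j|=1$ and $J_f(p)\tau_j=\mu_j\tau_j$; (v) $|\det J_f(p)|\le\lambda^{\frac{n+1}{2}}$ and $|\operatorname{tr}J_f(p)|\le\lambda+(n-1)\sqrt\lambda$; (vi) $\displaystyle\frac{\partial|f|}{\partial p}\,\Omega_{\mathbb B^n,p}(f(z))\le\Omega_{\mathbb B^n,p}(z)$ for all $z\in\mathbb B^n$, and equality holds for all $z\in\mathbb B^n$ if and only if $f$ is a holomorphic automorphism of $\mathbb B^n$ with $f(p)=p$. Moreover, the inequalities in (i), (iii) and (v) are sharp: for every $a\in\mathbb B^n$ there is such an $f$ with $f(0)=a$ and $\frac{\partial|f|}{\partial p}=\frac{|1-\langle f(0),p\rangle|^2}{1-|f(0)|^2}$; and for every $\lambda>0$ there is such an $f$ with $\frac{\partial|f|}{\partial p}=\lambda$, with $|\mu_j|=\sqrt\lambda$ for all $j=2,\dots,n$, and with equality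 in both inequalities of (v). -/

import Mathlib

/-- The open unit ball of `ℂⁿ` (with the Euclidean norm). -/
abbrev unitBall (n : ℕ) : Set (EuclideanSpace ℂ (Fin n)) :=
  Metric.ball (0 : EuclideanSpace ℂ (Fin n)) 1

/-- The complex Jacobian matrix `(∂f_j/∂z_k (z))` of `f : ℂⁿ → ℂⁿ`. -/
noncomputable def complexJacobian {n : ℕ}
    (f : EuclideanSpace ℂ (Fin n) → EuclideanSpace ℂ (Fin n))
    (z : EuclideanSpace ℂ (Fin n)) : Matrix (Fin n) (Fin n) ℂ :=
  Matrix.of fun j k => fderiv ℂ f z (EuclideanSpace.single k 1) j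

/-- `f` is a holomorphic self-map of the unit ball which is holomorphic at `p` (that is, it is
given near `p` by a convergent power series) and fixes `p`. Values of `f` outside
the ball and away from `p` play no role. -/
structure IsBallSelfMapFixing {n : ℕ} (p : EuclideanSpace ℂ (Fin n))
    (f : EuclideanSpace ℂ (Fin n) → EuclideanSpace ℂ (Fin n)) : Prop where
  holomorphic : DifferentiableOn ℂ f (unitBall n)
  mapsTo : Set.MapsTo f (unitBall n) (unitBall n)
  holomorphicAt : AnalyticAt ℂ f p
  fixes : f p = p

/-- `f` restricts to a holomorphic automorphism (biholomorphic self-map) of the unit ball. -/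
def IsBallAutomorphism {n : ℕ}
    (f : EuclideanSpace ℂ (Fin n) → EuclideanSpace ℂ (Fin n)) : Prop :=
  DifferentiableOn ℂ f (unitBall n) ∧ Set.MapsTo f (unitBall n) (unitBall n) ∧
    ∃ g : EuclideanSpace ℂ (Fin n) → EuclideanSpace ℂ (Fin n),
      DifferentiableOn ℂ g (unitBall n) ∧ Set.MapsTo g (unitBall n) (unitBall n) ∧
        Set.InvOn g f (unitBall n) (unitBall n)

/-- The complex tangent space `T_p^{(1,0)}(∂𝔹ⁿ) = {τ : ⟨τ, p⟩ = 0}` of the unit sphere at `p`. -/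
noncomputable def complexTangentSpace {n : ℕ} (p : EuclideanSpace ℂ (Fin n)) :
    Submodule ℂ (EuclideanSpace ℂ (Fin n)) :=
  (Submodule.span ℂ {p})ᗮ

/-- The complex tangent space is the maximal complex subspace of the real tangent space
`{τ : Re ⟨τ, p⟩ = 0}` of the unit sphere. -/
theorem mem_complexTangentSpace_iff {n : ℕ} (p τ : EuclideanSpace ℂ (Fin n)) :
    τ ∈ complexTangentSpace p ↔
      (inner ℂ p τ).re = 0 ∧ (inner ℂ p (Complex.I • τ)).re = 0 := by
  rw [complexTangentSpace, Submodule.mem_orthogonal_singleton_iff_inner_right, inner_smul_right,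
    Complex.ext_iff]
  simp

/-- The negative pluricomplex Poisson kernel
`Ω(z) = -(1 - |z|²) / |1 - ⟨z, p⟩|²` of the unit ball with pole `p`. With Mathlib's convention
(conjugate-linear in the first variable) `⟨z, p⟩ = ∑ z_j conj(p_j)` is `inner ℂ p z`. -/
noncomputable def pluricomplexPoissonKernel {n : ℕ} (p z : EuclideanSpace ℂ (Fin n)) : ℝ :=
  -((1 - ‖z‖ ^ 2) / ‖1 - inner ℂ p z‖ ^ 2)

/-! Let `D` be the derivative of `f` at `p` and `λ = Re ⟨p, D p⟩`. As `f` maps the ball into itself,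
`D` cannot send an inward direction to an outward one, and this forces `D* p = λ p`
(`adjoint_fderiv_apply_fixedPoint`). Differentiating `‖f‖²` along the radius identifies `λ` with the
directional derivative of `‖f‖`, and also with the radial limit of `(1 - ‖f‖²) / (1 - ‖z‖²)`. The
relation `⟨p, D v⟩ = λ ⟨p, v⟩` makes `λ` an eigenvalue and puts eigenvectors for all the others in
`p^⊥` (`exists_roots_charpoly_eq_cons`).

The estimates are radial limits of Schwarz–Pick. The two-point form becomes Julia's lemma
(`julia_ball`), which is the kernel inequality, and at `z = 0` the lower bound for `λ`. The
infinitesimal form on discs orthogonal to the radius becomes `‖D τ‖² ≤ λ` for unit `τ ⟂ p`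
(`norm_fderiv_apply_sq_le`), which bounds the other eigenvalues and with them determinant and trace.

If equality holds in Julia's lemma, following `f` by the involution at `f 0` gives a map fixing `0`
with factor one. The maximum principle makes it norm-preserving, hence a linear isometry, so `f` is
invertible. Conversely, Schwarz–Pick for the inverse reverses the inequality. Sharpness comes from
`chordMap`, whose image lies on one complex line, and from `ballDilation`, a hyperbolic
automorphism. -/

/-! ### Involutive automorphisms of the ball. -/

section BallInvolution

open Metric Set

variable {E : Type*} [NormedAddCommGroup E] [InnerProductSpace ℂ E]

/-- The numerator of the involution of the unit ball that exchanges `0` and `a`. -/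
noncomputable def ballInvolutionNum (a z : E) : E :=
  -- With `s = √(1 - ‖a‖²)` and `P`, `Q` the projections onto `ℂ a` and its complement, the usual
  -- numerator is `a - P z - s Q z`. Since `(1 - s) / ‖a‖² = 1 / (1 + s)`, this form agrees with it
  -- and needs no separate case `a = 0`.
  a - (Real.sqrt (1 - ‖a‖ ^ 2) : ℂ) • z -
    (inner ℂ a z / (1 + (Real.sqrt (1 - ‖a‖ ^ 2) : ℂ))) • a

/-- The involution of the unit ball that exchanges `0` and `a`. -/
noncomputable def ballInvolution (a z : E) : E :=
  (1 - inner ℂ a z)⁻¹ • ballInvolutionNum a z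

theorem one_sub_inner_ne_zero {a z : E} (ha : ‖a‖ < 1) (hz : ‖z‖ ≤ 1) : 1 - inner ℂ a z ≠ 0 := by
  intro h
  have h1 : ‖inner ℂ a z‖ ≤ ‖a‖ * ‖z‖ := norm_inner_le_norm a z
  rw [← sub_eq_zero.mp h, norm_one] at h1
  nlinarith [norm_nonneg a, norm_nonneg z]

theorem one_sub_inner_ne_zero' {a z : E} (ha : ‖a‖ ≤ 1) (hz : ‖z‖ < 1) :
    1 - inner ℂ a z ≠ 0 := by
  intro h
  have h1 : ‖inner ℂ a z‖ ≤ ‖a‖ * ‖z‖ := norm_inner_le_norm a z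
  rw [← sub_eq_zero.mp h, norm_one] at h1
  nlinarith [norm_nonneg a, norm_nonneg z]

theorem one_sub_inner_self (z : E) : 1 - inner ℂ z z = ((1 - ‖z‖ ^ 2 : ℝ) : ℂ) := by
  rw [inner_self_eq_norm_sq_to_K]
  push_cast
  rfl

theorem sqrt_one_sub_sq {a : E} (ha : ‖a‖ < 1) :
    ((Real.sqrt (1 - ‖a‖ ^ 2) : ℝ) : ℂ) ^ 2 = 1 - inner ℂ a a := by
  rw [one_sub_inner_self, ← Complex.ofReal_pow, Real.sq_sqrt]
  nlinarith [norm_nonneg a]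

theorem one_add_sqrt_ne_zero (r : ℝ) : (1 + (Real.sqrt r : ℂ)) ≠ 0 := by
  have : (0 : ℝ) < 1 + Real.sqrt r := by positivity
  exact_mod_cast this.ne'

/-- Division-free polarized form of the basic identity for the involution. The only relation behind
it is `s² = 1 - ⟨a, a⟩`; once `s` is opaque, it is pure algebra. -/
theorem inner_ballInvolutionNum {a : E} (ha : ‖a‖ < 1) (z w : E) :
    (1 - inner ℂ z a) * (1 - inner ℂ a w) -
      inner ℂ (ballInvolutionNum a z) (ballInvolutionNum a w) =
      (1 - inner ℂ a a) * (1 - inner ℂ z w) := by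
  have hs := sqrt_one_sub_sq ha
  have h1 := one_add_sqrt_ne_zero (1 - ‖a‖ ^ 2)
  simp only [ballInvolutionNum, inner_sub_left, inner_sub_right, inner_smul_left, inner_smul_right,
    map_div₀, map_add, map_one, Complex.conj_ofReal, inner_conj_symm]
  generalize ((Real.sqrt (1 - ‖a‖ ^ 2) : ℝ) : ℂ) = s at *
  have hA : inner ℂ a a = 1 - s ^ 2 := by rw [hs]; ring
  rw [hA]
  field_simp
  ring

theorem one_sub_inner_ballInvolution {a z w : E} (ha : ‖a‖ < 1) (hz : 1 - inner ℂ a z ≠ 0)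
    (hw : 1 - inner ℂ a w ≠ 0) :
    1 - inner ℂ (ballInvolution a z) (ballInvolution a w) =
      (1 - inner ℂ a a) * (1 - inner ℂ z w) / ((1 - inner ℂ z a) * (1 - inner ℂ a w)) := by
  have hz' : 1 - inner ℂ z a ≠ 0 := by
    have := (map_ne_zero (starRingEnd ℂ)).mpr hz
    simpa only [map_sub, map_one, inner_conj_symm] using this
  rw [← inner_ballInvolutionNum ha, ballInvolution, ballInvolution, inner_smul_left,
    inner_smul_right, map_inv₀, map_sub, map_one, inner_conj_symm]
  field_simp

theorem one_sub_norm_sq_ballInvolution {a z : E} (ha : ‖a‖ < 1) (hz : 1 - inner ℂ a z ≠ 0) :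
    1 - ‖ballInvolution a z‖ ^ 2 = (1 - ‖a‖ ^ 2) * (1 - ‖z‖ ^ 2) / ‖1 - inner ℂ a z‖ ^ 2 := by
  have h := one_sub_inner_ballInvolution ha hz hz
  have h2 : (1 - inner ℂ z a) * (1 - inner ℂ a z) = ((‖1 - inner ℂ a z‖ ^ 2 : ℝ) : ℂ) := by
    rw [← inner_conj_symm z a, ← map_one (starRingEnd ℂ), ← map_sub, map_one, Complex.conj_mul']
    push_cast
    rfl
  rw [h2, one_sub_inner_self, one_sub_inner_self, one_sub_inner_self] at h
  exact_mod_cast h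

theorem mapsTo_ballInvolution {a : E} (ha : ‖a‖ < 1) :
    MapsTo (ballInvolution a) (ball 0 1) (ball 0 1) := by
  intro z hz
  rw [mem_ball_zero_iff] at hz ⊢
  have h0 := one_sub_inner_ne_zero ha hz.le
  have h := one_sub_norm_sq_ballInvolution ha h0
  have : 0 < (1 - ‖a‖ ^ 2) * (1 - ‖z‖ ^ 2) / ‖1 - inner ℂ a z‖ ^ 2 := by
    have := norm_pos_iff.mpr h0
    have : 0 < 1 - ‖a‖ ^ 2 := by nlinarith [norm_nonneg a]
    have : 0 < 1 - ‖z‖ ^ 2 := by nlinarith [norm_nonneg z]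
    positivity
  nlinarith [norm_nonneg (ballInvolution a z)]

theorem norm_ballInvolution_of_norm_eq_one {a z : E} (ha : ‖a‖ < 1) (hz : ‖z‖ = 1) :
    ‖ballInvolution a z‖ = 1 := by
  have h := one_sub_norm_sq_ballInvolution ha (one_sub_inner_ne_zero ha hz.le)
  rw [hz] at h
  simp only [one_pow, sub_self, mul_zero, zero_div] at h
  exact (pow_eq_one_iff_of_nonneg (norm_nonneg _) two_ne_zero).mp (by linarith)

@[simp]
theorem ballInvolution_zero (a : E) : ballInvolution a 0 = a := by
  simp [ballInvolution, ballInvolutionNum]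

theorem ballInvolutionNum_self {a : E} (ha : ‖a‖ < 1) : ballInvolutionNum a a = 0 := by
  have hs := sqrt_one_sub_sq ha
  have h1 := one_add_sqrt_ne_zero (1 - ‖a‖ ^ 2)
  rw [ballInvolutionNum]
  generalize ((Real.sqrt (1 - ‖a‖ ^ 2) : ℝ) : ℂ) = s at *
  have hA : inner ℂ a a = 1 - s ^ 2 := by rw [hs]; ring
  have : 1 - s - inner ℂ a a / (1 + s) = 0 := by rw [hA]; field_simp; ring
  calc a - s • a - (inner ℂ a a / (1 + s)) • a = (1 - s - inner ℂ a a / (1 + s)) • a := by module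
    _ = 0 := by rw [this, zero_smul]

@[simp]
theorem ballInvolution_self {a : E} (ha : ‖a‖ < 1) : ballInvolution a a = 0 := by
  rw [ballInvolution, ballInvolutionNum_self ha, smul_zero]

theorem ballInvolution_ballInvolution {a z : E} (ha : ‖a‖ < 1) (hz : 1 - inner ℂ a z ≠ 0) :
    ballInvolution a (ballInvolution a z) = z := by
  have hs := sqrt_one_sub_sq ha
  have h1 := one_add_sqrt_ne_zero (1 - ‖a‖ ^ 2)
  have hA0 : 1 - inner ℂ a a ≠ 0 := one_sub_inner_ne_zero ha ha.le
  have hi : 1 - inner ℂ a (ballInvolution a z) = (1 - inner ℂ a a) / (1 - inner ℂ a z) := by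
    have := one_sub_inner_ballInvolution (z := 0) ha (by simp) hz
    simpa using this
  have hi' : inner ℂ a (ballInvolution a z) = 1 - (1 - inner ℂ a a) / (1 - inner ℂ a z) := by
    rw [← hi]; ring
  rw [ballInvolution, hi, ballInvolutionNum, hi', ballInvolution, ballInvolutionNum]
  generalize ((Real.sqrt (1 - ‖a‖ ^ 2) : ℝ) : ℂ) = s at *
  have hA : inner ℂ a a = 1 - s ^ 2 := by rw [hs]; ring
  rw [hA] at hA0 ⊢
  have hs0 : s ≠ 0 := by rintro rfl; simp at hA0
  generalize inner ℂ a z = y at *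
  simp only [sub_sub_cancel]
  match_scalars <;> field_simp
  ring

theorem invOn_ballInvolution {a : E} (ha : ‖a‖ < 1) :
    InvOn (ballInvolution a) (ballInvolution a) (ball 0 1) (ball 0 1) := by
  have h : LeftInvOn (ballInvolution a) (ballInvolution a) (ball 0 1) := fun z hz =>
    ballInvolution_ballInvolution ha (one_sub_inner_ne_zero ha (mem_ball_zero_iff.mp hz).le)
  exact ⟨h, h⟩

theorem differentiableOn_ballInvolution {a : E} (ha : ‖a‖ < 1) :
    DifferentiableOn ℂ (ballInvolution a) (ball 0 1) := by
  have hi : Differentiable ℂ (fun z : E => inner ℂ a z) := (innerSL ℂ a).differentiable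
  unfold ballInvolution ballInvolutionNum
  refine DifferentiableOn.smul (DifferentiableOn.inv (by fun_prop) fun z hz =>
    one_sub_inner_ne_zero ha (mem_ball_zero_iff.mp hz).le) ?_
  fun_prop

/-- The numerator is affine in `z` and vanishes at `a`, so it is minus a sum of two vectors built
from `z - a`, whose inner product is nonnegative; one of them has norm `s ‖z - a‖`. This lower bound
replaces differentiating the involution at its zero. -/
theorem sqrt_mul_norm_sub_le_norm_ballInvolutionNum {a : E} (ha : ‖a‖ < 1) (z : E) :
    Real.sqrt (1 - ‖a‖ ^ 2) * ‖z - a‖ ≤ ‖ballInvolutionNum a z‖ := by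
  have hpos : 0 ≤ 1 - ‖a‖ ^ 2 := by nlinarith [norm_nonneg a]
  have hs0 := Real.sqrt_nonneg (1 - ‖a‖ ^ 2)
  have hs2 := Real.sq_sqrt hpos
  have h0 := ballInvolutionNum_self ha
  set s : ℝ := Real.sqrt (1 - ‖a‖ ^ 2) with hs
  set v := z - a with hv
  set c : ℂ := inner ℂ a v with hc
  have hN : ballInvolutionNum a z = -((s : ℂ) • v + (c / (1 + (s : ℂ))) • a) := by
    rw [← sub_zero (ballInvolutionNum a z), ← h0, ballInvolutionNum, ballInvolutionNum, hc, hv,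
      inner_sub_right, sub_div]
    module
  have hre : RCLike.re (inner ℂ ((s : ℂ) • v) ((c / (1 + (s : ℂ))) • a)) =
      s * ‖c‖ ^ 2 / (1 + s) := by
    have : inner ℂ ((s : ℂ) • v) ((c / (1 + (s : ℂ))) • a) =
        ((s * ‖c‖ ^ 2 / (1 + s) : ℝ) : ℂ) := by
      rw [inner_smul_left, inner_smul_right, ← inner_conj_symm v a, ← hc, Complex.conj_ofReal]
      push_cast
      rw [← Complex.mul_conj']
      ring
    rw [this]
    exact Complex.ofReal_re _
  have hsq : (s * ‖v‖) ^ 2 ≤ ‖ballInvolutionNum a z‖ ^ 2 := by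
    rw [hN, norm_neg, norm_add_sq (𝕜 := ℂ), hre, norm_smul, Complex.norm_real, Real.norm_eq_abs,
      abs_of_nonneg hs0]
    have : 0 ≤ s * ‖c‖ ^ 2 / (1 + s) := by positivity
    nlinarith [sq_nonneg ‖(c / (1 + (s : ℂ))) • a‖]
  exact le_of_sq_le_sq hsq (norm_nonneg _)

end BallInvolution

/-! ### Schwarz–Pick, two-point and infinitesimal. -/

section SchwarzPick

open Metric Set

variable {E F : Type*} [NormedAddCommGroup E] [InnerProductSpace ℂ E]
  [NormedAddCommGroup F] [InnerProductSpace ℂ F]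

/-- The **Schwarz–Pick lemma** for maps between unit balls. -/
theorem schwarzPick_ball {f : E → F} (hf : DifferentiableOn ℂ f (ball 0 1))
    (hm : MapsTo f (ball 0 1) (ball 0 1)) {a z : E} (ha : a ∈ ball (0 : E) 1)
    (hz : z ∈ ball (0 : E) 1) :
    (1 - ‖a‖ ^ 2) * (1 - ‖z‖ ^ 2) * ‖1 - inner ℂ (f a) (f z)‖ ^ 2 ≤
      (1 - ‖f a‖ ^ 2) * (1 - ‖f z‖ ^ 2) * ‖1 - inner ℂ a z‖ ^ 2 := by
  have ha' := mem_ball_zero_iff.mp ha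
  have hz' := mem_ball_zero_iff.mp hz
  have hfa := mem_ball_zero_iff.mp (hm ha)
  have hfz := mem_ball_zero_iff.mp (hm hz)
  have hd : DifferentiableOn ℂ (ballInvolution (f a) ∘ f ∘ ballInvolution a) (ball 0 1) :=
    (differentiableOn_ballInvolution hfa).comp
      (hf.comp (differentiableOn_ballInvolution ha') (mapsTo_ballInvolution ha'))
      (hm.comp (mapsTo_ballInvolution ha'))
  have hmt : MapsTo (ballInvolution (f a) ∘ f ∘ ballInvolution a) (ball 0 1) (closedBall 0 1) :=
    ((mapsTo_ballInvolution hfa).comp (hm.comp (mapsTo_ballInvolution ha'))).mono_right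
      ball_subset_closedBall
  -- The conjugated map fixes `0`, so Schwarz applies; at `ballInvolution a z` the inner involution
  -- cancels.
  have hle := Complex.norm_le_norm_of_mapsTo_ball hd hmt (by simp [hfa])
    (mem_ball_zero_iff.mp (mapsTo_ballInvolution ha' hz))
  have h1 := one_sub_inner_ne_zero ha' hz'.le
  have h2 := one_sub_inner_ne_zero hfa hfz.le
  simp only [Function.comp_apply, ballInvolution_ballInvolution ha' h1] at hle
  have e1 := one_sub_norm_sq_ballInvolution ha' h1
  have e2 := one_sub_norm_sq_ballInvolution hfa h2
  have hsq : ‖ballInvolution (f a) (f z)‖ ^ 2 ≤ ‖ballInvolution a z‖ ^ 2 := by gcongr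
  have hdiv : (1 - ‖a‖ ^ 2) * (1 - ‖z‖ ^ 2) / ‖1 - inner ℂ a z‖ ^ 2 ≤
      (1 - ‖f a‖ ^ 2) * (1 - ‖f z‖ ^ 2) / ‖1 - inner ℂ (f a) (f z)‖ ^ 2 := by
    rw [← e1, ← e2]; linarith
  have p1 := norm_pos_iff.mpr h1
  have p2 := norm_pos_iff.mpr h2
  rwa [div_le_div_iff₀ (by positivity) (by positivity)] at hdiv

/-- The infinitesimal Schwarz–Pick lemma for a disc of radius `R` in the unit ball. -/
theorem norm_deriv_sq_le_of_mapsTo_ball {h : ℂ → F} {R : ℝ} (hR : 0 < R)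
    (hd : DifferentiableOn ℂ h (ball 0 R)) (hm : MapsTo h (ball 0 R) (ball 0 1)) {v : F}
    (hv : HasDerivAt h v 0) : R ^ 2 * ‖v‖ ^ 2 ≤ 1 - ‖h 0‖ ^ 2 := by
  have h0 : (0 : ℂ) ∈ ball (0 : ℂ) R := by simpa using hR
  have ha := mem_ball_zero_iff.mp (hm h0)
  have hpos : 0 < 1 - ‖h 0‖ ^ 2 := by nlinarith [norm_nonneg (h 0)]
  set s := Real.sqrt (1 - ‖h 0‖ ^ 2) with hs
  have hspos : 0 < s := Real.sqrt_pos.mpr hpos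
  have hs2 : s ^ 2 = 1 - ‖h 0‖ ^ 2 := Real.sq_sqrt hpos.le
  have key : ∀ ζ ∈ ball (0 : ℂ) R, s * ‖h ζ - h 0‖ ≤ ‖1 - inner ℂ (h 0) (h ζ)‖ * (‖ζ‖ / R) := by
    intro ζ hζ
    have hz := mem_ball_zero_iff.mp (hm hζ)
    have hle := Complex.dist_le_div_mul_dist_of_mapsTo_ball (R₂ := 1)
      (f := ballInvolution (h 0) ∘ h)
      ((differentiableOn_ballInvolution ha).comp hd hm)
      (by
        rw [Function.comp_apply, ballInvolution_self ha]
        exact ((mapsTo_ballInvolution ha).comp hm).mono_right ball_subset_closedBall) hζ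
    rw [Function.comp_apply, Function.comp_apply, ballInvolution_self ha, dist_zero_right,
      dist_zero_right, ballInvolution, norm_smul, norm_inv] at hle
    have hn := norm_pos_iff.mpr (one_sub_inner_ne_zero ha hz.le)
    refine (sqrt_mul_norm_sub_le_norm_ballInvolutionNum ha (h ζ)).trans ?_
    rw [inv_mul_le_iff₀ hn] at hle
    calc _ ≤ _ := hle
      _ = _ := by ring
  -- Divide `key` by `‖ζ‖` and let `ζ → 0`; the first factor on the right is `s²`, so one `s`
  -- cancels afterwards.
  have hlim : s * ‖v‖ ≤ ‖1 - inner ℂ (h 0) (h 0)‖ * (1 / R) := by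
    have hcont : Filter.Tendsto h (nhdsWithin 0 {0}ᶜ) (nhds (h 0)) :=
      hv.continuousAt.tendsto.mono_left nhdsWithin_le_nhds
    have hsl := hv.tendsto_slope
    refine le_of_tendsto_of_tendsto (hsl.norm.const_mul s)
      (((tendsto_const_nhds.sub ((tendsto_const_nhds (x := h 0)).inner hcont)).norm).mul_const _) ?_
    filter_upwards [self_mem_nhdsWithin, mem_nhdsWithin_of_mem_nhds (ball_mem_nhds _ hR)]
      with ζ hne hζ
    have hpn : 0 < ‖ζ‖ := norm_pos_iff.mpr hne
    rw [slope_def_module, sub_zero, norm_smul, norm_inv]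
    have := key ζ hζ
    calc s * (‖ζ‖⁻¹ * ‖h ζ - h 0‖) = ‖ζ‖⁻¹ * (s * ‖h ζ - h 0‖) := by ring
      _ ≤ ‖ζ‖⁻¹ * (‖1 - inner ℂ (h 0) (h ζ)‖ * (‖ζ‖ / R)) := by gcongr
      _ = _ := by field_simp
  rw [one_sub_inner_self, Complex.norm_real, Real.norm_eq_abs, abs_of_pos hpos, ← hs2] at hlim
  have h3 : R * ‖v‖ ≤ s := by
    have : s * (R * ‖v‖) ≤ s * s := by
      calc s * (R * ‖v‖) = (s * ‖v‖) * R := by ring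
        _ ≤ (s ^ 2 * (1 / R)) * R := by gcongr
        _ = s * s := by field_simp
    exact le_of_mul_le_mul_left this hspos
  rw [← hs2, ← mul_pow]
  gcongr

end SchwarzPick

/-! ### Boundary derivative, Julia's lemma and the tangential estimate. -/

section Boundary

open Metric Set Filter Topology

variable {E : Type*} [NormedAddCommGroup E] [InnerProductSpace ℂ E]

theorem norm_add_real_smul_sq (p v : E) (hp : ‖p‖ = 1) (t : ℝ) :
    ‖p + t • v‖ ^ 2 = 1 + t * (2 * (inner ℂ p v).re + t * ‖v‖ ^ 2) := by
  have h := norm_add_sq (𝕜 := ℂ) p (t • v)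
  rw [h, hp, norm_smul, Real.norm_eq_abs, mul_pow, sq_abs, ← Complex.coe_smul, inner_smul_right]
  simp only [RCLike.re_to_complex, Complex.re_ofReal_mul]
  ring

theorem eventually_add_real_smul_mem_ball {p v : E} (hp : ‖p‖ = 1) (hv : (inner ℂ p v).re < 0) :
    ∀ᶠ t : ℝ in 𝓝[>] 0, p + t • v ∈ ball (0 : E) 1 := by
  have h : Tendsto (fun t : ℝ => 2 * (inner ℂ p v).re + t * ‖v‖ ^ 2) (𝓝 0)
      (𝓝 (2 * (inner ℂ p v).re + 0 * ‖v‖ ^ 2)) := by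
    apply Continuous.tendsto
    fun_prop
  filter_upwards [self_mem_nhdsWithin, mem_nhdsWithin_of_mem_nhds
    (h.eventually (gt_mem_nhds (by linarith : 2 * (inner ℂ p v).re + 0 * ‖v‖ ^ 2 < 0)))]
    with t ht h2
  rw [mem_ball_zero_iff]
  have := norm_add_real_smul_sq p v hp t
  have : t * (2 * (inner ℂ p v).re + t * ‖v‖ ^ 2) < 0 := mul_neg_of_pos_of_neg ht h2
  nlinarith [norm_nonneg (p + t • v)]

theorem hasDerivAt_comp_line {f : E → E} {p : E} {D : E →L[ℂ] E} (hD : HasFDerivAt f D p) (v : E) :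
    HasDerivAt (fun t : ℝ => f (p + t • v)) (D v) 0 := by
  have h : HasDerivAt (fun t : ℝ => p + t • v) v 0 := by
    simpa using ((hasDerivAt_id (0 : ℝ)).smul_const v).const_add p
  have hD' : HasFDerivAt f (D.restrictScalars ℝ) (p + (0 : ℝ) • v) := by
    simpa using hD.restrictScalars ℝ
  exact hD'.comp_hasDerivAt 0 h

/-- For an inward `v`, `t ↦ Re ⟨p, f (p + t v)⟩` equals `1` at `t = 0` and is at most `1` for small
`t > 0`. -/
theorem re_inner_fderiv_nonpos {f : E → E} {p : E} {D : E →L[ℂ] E}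
    (hm : MapsTo f (ball 0 1) (ball 0 1)) (hp : ‖p‖ = 1) (hfp : f p = p)
    (hD : HasFDerivAt f D p) {v : E} (hv : (inner ℂ p v).re < 0) : (inner ℂ p (D v)).re ≤ 0 := by
  have h1 : HasDerivAt (fun t : ℝ => (inner ℂ p (f (p + t • v))).re) (inner ℂ p (D v)).re 0 := by
    have := (((innerSL ℂ p).restrictScalars ℝ).hasFDerivAt).comp_hasDerivAt (0 : ℝ)
      (hasDerivAt_comp_line hD v)
    exact Complex.reCLM.hasFDerivAt.comp_hasDerivAt (0 : ℝ) this
  refine le_of_tendsto (h1.tendsto_slope.mono_left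
    (nhdsWithin_mono (s := Ioi 0) (t := {0}ᶜ) (0 : ℝ) (fun x hx => ne_of_gt hx))) ?_
  filter_upwards [self_mem_nhdsWithin, eventually_add_real_smul_mem_ball hp hv] with t ht hb
  have hb' := mem_ball_zero_iff.mp (hm hb)
  have h2 : (inner ℂ p (f (p + t • v))).re ≤ 1 := by
    refine (Complex.re_le_norm _).trans ((norm_inner_le_norm _ _).trans ?_)
    rw [hp, one_mul]
    exact hb'.le
  have h3 : (inner ℂ p (f (p + (0 : ℝ) • v))).re = 1 := by
    simp [hfp, inner_self_eq_norm_sq_to_K, hp]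
  rw [slope_def_field, h3, sub_zero]
  exact div_nonpos_of_nonpos_of_nonneg (by linarith) (le_of_lt ht)

/-- At a boundary fixed point `p`, the vector `p` is an eigenvector of the adjoint derivative. -/
theorem adjoint_fderiv_apply_fixedPoint [CompleteSpace E] {f : E → E} {p : E} {D : E →L[ℂ] E}
    (hm : MapsTo f (ball 0 1) (ball 0 1)) (hp : ‖p‖ = 1) (hfp : f p = p)
    (hD : HasFDerivAt f D p) :
    ContinuousLinearMap.adjoint D p = ((inner ℂ p (D p)).re : ℂ) • p := by
  set q := ContinuousLinearMap.adjoint D p with hq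
  have hqv : ∀ v, inner ℂ p (D v) = inner ℂ q v := fun v =>
    (ContinuousLinearMap.adjoint_inner_left D v p).symm
  have hpp : inner ℂ p p = 1 := by simp [inner_self_eq_norm_sq_to_K, hp]
  set c := (inner ℂ p (D p)).re with hc
  have hcq : (inner ℂ p q).re = c := by
    rw [hc, hqv, ← inner_conj_symm, Complex.conj_re]
  -- Only the real part of `⟨p, q⟩` is removed, so `v` is merely real-tangent to the sphere. That
  -- `v` vanishes then also shows that `⟨p, D p⟩` is real.
  set v := q - (c : ℂ) • p with hv
  have hpv : (inner ℂ p v).re = 0 := by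
    rw [hv, inner_sub_right, inner_smul_right, hpp, mul_one, Complex.sub_re, hcq,
      Complex.ofReal_re, sub_self]
  -- The tangent vector `v` is tilted to the strictly inward `v - ε p`, and `ε → 0`. The same
  -- quantity equals `‖v‖²`, so `v = 0`.
  have hle : (inner ℂ q v).re ≤ 0 := by
    refine le_of_tendsto (f := fun ε : ℝ => (inner ℂ q (v - (ε : ℂ) • p)).re) (x := 𝓝[>] 0) ?_ ?_
    · have : Continuous fun ε : ℝ => (inner ℂ q (v - (ε : ℂ) • p)).re := by fun_prop
      simpa using (this.tendsto 0).mono_left nhdsWithin_le_nhds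
    · filter_upwards [self_mem_nhdsWithin] with ε hε
      rw [← hqv]
      refine re_inner_fderiv_nonpos hm hp hfp hD ?_
      rw [inner_sub_right, inner_smul_right, hpp, mul_one, Complex.sub_re, hpv, Complex.ofReal_re]
      simpa using hε
  have hqd : q = v + (c : ℂ) • p := by rw [hv]; abel
  have : (inner ℂ q v).re = ‖v‖ ^ 2 := by
    rw [hqd, inner_add_left, inner_smul_left, Complex.conj_ofReal, Complex.add_re,
      Complex.re_ofReal_mul, hpv, mul_zero, add_zero]
    exact inner_self_eq_norm_sq (𝕜 := ℂ) v
  have hv0 : v = 0 := by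
    rw [← norm_eq_zero]
    nlinarith [norm_nonneg v]
  rw [hqd, hv0, zero_add]

theorem hasDerivAt_norm_sq_comp_line {f : E → E} {p : E} {D : E →L[ℂ] E} (hfp : f p = p)
    (hD : HasFDerivAt f D p) :
    HasDerivAt (fun t : ℝ => ‖f (p + t • p)‖ ^ 2) (2 * (inner ℂ p (D p)).re) 0 := by
  let _ : InnerProductSpace ℝ E := InnerProductSpace.rclikeToReal ℂ E
  have h := (hasDerivAt_comp_line hD p).norm_sq
  simpa [hfp, real_inner_eq_re_inner ℂ] using h

theorem hasLineDerivAt_norm {f : E → E} {p : E} {D : E →L[ℂ] E} (hp : ‖p‖ = 1) (hfp : f p = p)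
    (hD : HasFDerivAt f D p) :
    HasLineDerivAt ℝ (fun z => ‖f z‖) (inner ℂ p (D p)).re p p := by
  have h := (hasDerivAt_norm_sq_comp_line hfp hD).sqrt (by simp [hfp, hp])
  have h2 : (2 * (inner ℂ p (D p)).re) / (2 * Real.sqrt (‖f (p + (0 : ℝ) • p)‖ ^ 2)) =
      (inner ℂ p (D p)).re := by
    simp [hfp, hp]
  rw [h2] at h
  simpa only [HasLineDerivAt, Real.sqrt_sq (norm_nonneg _)] using h

/-- Both numerator and denominator vanish at `t = 0`, so this is a quotient of two difference
quotients, for `f` and for the identity. Here `t < 0` since `p + t p` must approach `p` from inside.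
-/
theorem tendsto_one_sub_norm_sq_div {f : E → E} {p : E} {D : E →L[ℂ] E} (hp : ‖p‖ = 1)
    (hfp : f p = p) (hD : HasFDerivAt f D p) :
    Tendsto (fun t : ℝ => (1 - ‖f (p + t • p)‖ ^ 2) / (1 - ‖p + t • p‖ ^ 2)) (𝓝[<] 0)
      (𝓝 (inner ℂ p (D p)).re) := by
  have h1 := (hasDerivAt_norm_sq_comp_line hfp hD).tendsto_slope
  have h2 := (hasDerivAt_norm_sq_comp_line (f := id) (D := .id ℂ E) rfl
    (hasFDerivAt_id p)).tendsto_slope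
  have hpp : inner ℂ p p = 1 := by simp [inner_self_eq_norm_sq_to_K, hp]
  simp only [ContinuousLinearMap.id_apply, hpp, Complex.one_re, mul_one, id] at h2
  have h3 := (h1.div h2 two_ne_zero).mono_left
    (nhdsWithin_mono (s := Iio 0) (t := {0}ᶜ) (0 : ℝ) (fun x hx => ne_of_lt hx))
  rw [mul_div_cancel_left₀ _ two_ne_zero] at h3
  refine h3.congr' ?_
  filter_upwards [self_mem_nhdsWithin] with t ht
  have ht0 : t ≠ 0 := ne_of_lt ht
  simp only [Pi.div_apply, slope_def_field, zero_smul, add_zero, hfp, hp, sub_zero, one_pow]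
  rw [div_div_div_cancel_right₀ ht0, ← neg_sub (1 : ℝ), ← neg_sub (1 : ℝ), neg_div_neg_eq]

theorem add_real_smul_self_mem_ball {p : E} (hp : ‖p‖ = 1) :
    ∀ᶠ t : ℝ in 𝓝[<] 0, p + t • p ∈ ball (0 : E) 1 := by
  filter_upwards [Ioo_mem_nhdsLT (show (-1 : ℝ) < 0 by norm_num)] with t ht
  rw [mem_ball_zero_iff, ← one_smul ℝ p, smul_smul, ← add_smul, norm_smul, hp, mul_one, mul_one,
    Real.norm_eq_abs, abs_lt]
  constructor <;> linarith [ht.1, ht.2]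

theorem one_sub_norm_sq_pos {E : Type*} [NormedAddCommGroup E] {z : E} (hz : z ∈ ball (0 : E) 1) : 0 < 1 - ‖z‖ ^ 2 := by
  rw [mem_ball_zero_iff] at hz
  nlinarith [norm_nonneg z]

theorem tendsto_schwarzPick_right {f : E → E} {p : E} {D : E →L[ℂ] E} (hp : ‖p‖ = 1)
    (hfp : f p = p) (hD : HasFDerivAt f D p) (z : E) :
    Tendsto (fun t : ℝ => (1 - ‖f (p + t • p)‖ ^ 2) / (1 - ‖p + t • p‖ ^ 2) *
      ((1 - ‖f z‖ ^ 2) * ‖1 - inner ℂ (p + t • p) z‖ ^ 2)) (𝓝[<] 0)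
      (𝓝 ((inner ℂ p (D p)).re * ((1 - ‖f z‖ ^ 2) * ‖1 - inner ℂ p z‖ ^ 2))) := by
  refine (tendsto_one_sub_norm_sq_div hp hfp hD).mul ?_
  have : Continuous fun t : ℝ => (1 - ‖f z‖ ^ 2) * ‖1 - inner ℂ (p + t • p) z‖ ^ 2 := by fun_prop
  simpa using (this.tendsto 0).mono_left nhdsWithin_le_nhds

theorem tendsto_schwarzPick_left {f : E → E} {p : E} {D : E →L[ℂ] E}
    (hfp : f p = p) (hD : HasFDerivAt f D p) (z : E) :
    Tendsto (fun t : ℝ => (1 - ‖z‖ ^ 2) * ‖1 - inner ℂ (f (p + t • p)) (f z)‖ ^ 2) (𝓝[<] 0)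
      (𝓝 ((1 - ‖z‖ ^ 2) * ‖1 - inner ℂ p (f z)‖ ^ 2)) := by
  have h := (hasDerivAt_comp_line hD p).continuousAt.tendsto
  rw [zero_smul, add_zero, hfp] at h
  exact ((((tendsto_const_nhds.sub (h.inner tendsto_const_nhds)).norm).pow 2).const_mul _).mono_left
    nhdsWithin_le_nhds

/-- **Julia's lemma** for the unit ball. -/
theorem julia_ball {f : E → E} {p : E} {D : E →L[ℂ] E} (hf : DifferentiableOn ℂ f (ball 0 1))
    (hm : MapsTo f (ball 0 1) (ball 0 1)) (hp : ‖p‖ = 1) (hfp : f p = p)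
    (hD : HasFDerivAt f D p) {z : E} (hz : z ∈ ball (0 : E) 1) :
    (1 - ‖z‖ ^ 2) * ‖1 - inner ℂ p (f z)‖ ^ 2 ≤
      (inner ℂ p (D p)).re * ((1 - ‖f z‖ ^ 2) * ‖1 - inner ℂ p z‖ ^ 2) := by
  refine le_of_tendsto_of_tendsto (tendsto_schwarzPick_left hfp hD z)
    (tendsto_schwarzPick_right hp hfp hD z) ?_
  filter_upwards [add_real_smul_self_mem_ball hp] with t ht
  have h := schwarzPick_ball hf hm ht hz
  have hpos := one_sub_norm_sq_pos ht
  rw [div_mul_eq_mul_div, le_div_iff₀ hpos]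
  linarith

/-- Biholomorphic self-maps of the ball attain equality in Julia's lemma. -/
theorem julia_ball_eq_of_inverse {f g : E → E} {p : E} {D : E →L[ℂ] E}
    (hf : DifferentiableOn ℂ f (ball 0 1)) (hm : MapsTo f (ball 0 1) (ball 0 1))
    (hg : DifferentiableOn ℂ g (ball 0 1)) (hgm : MapsTo g (ball 0 1) (ball 0 1))
    (hgf : LeftInvOn g f (ball 0 1)) (hp : ‖p‖ = 1) (hfp : f p = p)
    (hD : HasFDerivAt f D p) {z : E} (hz : z ∈ ball (0 : E) 1) :
    (1 - ‖z‖ ^ 2) * ‖1 - inner ℂ p (f z)‖ ^ 2 =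
      (inner ℂ p (D p)).re * ((1 - ‖f z‖ ^ 2) * ‖1 - inner ℂ p z‖ ^ 2) := by
  refine le_antisymm (julia_ball hf hm hp hfp hD hz) ?_
  refine le_of_tendsto_of_tendsto (tendsto_schwarzPick_right hp hfp hD z)
    (tendsto_schwarzPick_left hfp hD z) ?_
  filter_upwards [add_real_smul_self_mem_ball hp] with t ht
  -- Schwarz–Pick for the inverse reverses the inequality at interior points, before the limit, so
  -- `g` needs no regularity at the boundary.
  have h := schwarzPick_ball hg hgm (hm ht) (hm hz)
  rw [hgf ht, hgf hz] at h
  have hpos := one_sub_norm_sq_pos ht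
  rw [div_mul_eq_mul_div, div_le_iff₀ hpos]
  linarith

/-- At `a = p + t p` the vector `τ` is orthogonal to `a`, so the disc `a + ζ τ` with `‖ζ‖² < 1 -
‖a‖²` lies in the ball. Infinitesimal Schwarz–Pick on it bounds `‖Df(a) τ‖²` by the quotient that
tends to `λ`; analyticity at `p` makes the left side converge. -/
theorem norm_fderiv_apply_sq_le [CompleteSpace E] {f : E → E} {p τ : E}
    (hf : DifferentiableOn ℂ f (ball 0 1)) (hm : MapsTo f (ball 0 1) (ball 0 1)) (hp : ‖p‖ = 1)
    (hfp : f p = p) (hfa : AnalyticAt ℂ f p) (hτ : ‖τ‖ = 1) (hpτ : inner ℂ p τ = 0) :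
    ‖fderiv ℂ f p τ‖ ^ 2 ≤ (inner ℂ p (fderiv ℂ f p p)).re := by
  have hD := hfa.differentiableAt.hasFDerivAt
  have hcont : Tendsto (fun t : ℝ => ‖fderiv ℂ f (p + t • p) τ‖ ^ 2) (𝓝[<] 0)
      (𝓝 (‖fderiv ℂ f p τ‖ ^ 2)) := by
    have h1 : ContinuousAt (fderiv ℂ f) (p + (0 : ℝ) • p) := by
      simpa using hfa.fderiv.continuousAt
    have h2 : ContinuousAt (fun t : ℝ => fderiv ℂ f (p + t • p)) 0 :=
      ContinuousAt.comp (f := fun t : ℝ => p + t • p) h1 (by fun_prop)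
    have h3 : Tendsto (fun t : ℝ => ‖fderiv ℂ f (p + t • p) τ‖ ^ 2) (𝓝 0)
        (𝓝 (‖fderiv ℂ f (p + (0 : ℝ) • p) τ‖ ^ 2)) :=
      (((h2.clm_apply (continuousAt_const (y := τ))).norm).pow 2).tendsto
    rw [zero_smul, add_zero] at h3
    exact h3.mono_left nhdsWithin_le_nhds
  refine le_of_tendsto_of_tendsto hcont (tendsto_one_sub_norm_sq_div hp hfp hD) ?_
  filter_upwards [add_real_smul_self_mem_ball hp] with t ht
  have hpos := one_sub_norm_sq_pos ht
  set a := p + t • p with ha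
  have haτ : inner ℂ a τ = 0 := by
    rw [ha, inner_add_left, ← Complex.coe_smul, inner_smul_left, hpτ]
    simp
  have hmem : MapsTo (fun ζ : ℂ => a + ζ • τ) (ball 0 (Real.sqrt (1 - ‖a‖ ^ 2))) (ball 0 1) := by
    intro ζ hζ
    rw [mem_ball_zero_iff] at hζ ⊢
    have h1 : ‖ζ‖ ^ 2 < 1 - ‖a‖ ^ 2 := by
      rw [← Real.sq_sqrt hpos.le]
      gcongr
    have h2 : ‖a + ζ • τ‖ ^ 2 = ‖a‖ ^ 2 + ‖ζ‖ ^ 2 := by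
      rw [norm_add_sq (𝕜 := ℂ), inner_smul_right, haτ, norm_smul, hτ]
      simp
    nlinarith [norm_nonneg (a + ζ • τ)]
  have hder : HasDerivAt (fun ζ : ℂ => f (a + ζ • τ)) (fderiv ℂ f a τ) 0 := by
    have h1 : HasFDerivAt f (fderiv ℂ f a) (a + (0 : ℂ) • τ) := by
      rw [zero_smul, add_zero]
      exact (hf.differentiableAt (isOpen_ball.mem_nhds ht)).hasFDerivAt
    have h2 : HasDerivAt (fun ζ : ℂ => a + ζ • τ) τ 0 := by
      simpa using ((hasDerivAt_id (0 : ℂ)).smul_const τ).const_add a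
    exact h1.comp_hasDerivAt 0 h2
  have h := norm_deriv_sq_le_of_mapsTo_ball (Real.sqrt_pos.mpr hpos)
    (hf.comp (by fun_prop) hmem) (hm.comp hmem) hder
  simp only [Function.comp_apply, zero_smul, add_zero] at h
  rw [Real.sq_sqrt hpos.le] at h
  rw [le_div_iff₀ hpos]
  linarith

end Boundary

/-! ### Equality in Julia's lemma forces an automorphism. -/

section Rigidity

open Metric Set Filter Topology

variable {E : Type*} [NormedAddCommGroup E] [InnerProductSpace ℂ E]

/-- A holomorphic map of the unit ball that preserves norms agrees with its derivative at `0`. -/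
theorem eq_fderiv_apply_of_norm_eq {g : E → E} (hg : DifferentiableOn ℂ g (ball 0 1))
    (hn : ∀ z ∈ ball (0 : E) 1, ‖g z‖ = ‖z‖) {z : E} (hz : z ∈ ball (0 : E) 1) :
    g z = fderiv ℂ g 0 z := by
  have hg0 : g 0 = 0 := by
    rw [← norm_eq_zero, hn 0 (mem_ball_self one_pos), norm_zero]
  rcases eq_or_ne z 0 with rfl | hz0
  · rw [hg0, map_zero]
  have hzpos := norm_pos_iff.mpr hz0
  have hz1 := mem_ball_zero_iff.mp hz
  have hline : MapsTo (fun ζ : ℂ => ζ • z) (ball 0 (1 / ‖z‖)) (ball 0 1) := by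
    intro ζ hζ
    rw [mem_ball_zero_iff] at hζ ⊢
    rwa [norm_smul, ← lt_div_iff₀ hzpos]
  have hd : DifferentiableOn ℂ (fun ζ : ℂ => g (ζ • z)) (ball 0 (1 / ‖z‖)) :=
    hg.comp (by fun_prop) hline
  have hm : MapsTo (fun ζ : ℂ => g (ζ • z)) (ball 0 (1 / ‖z‖))
      (closedBall ((fun ζ : ℂ => g (ζ • z)) 0) 1) := by
    intro ζ hζ
    simp only [zero_smul, hg0, mem_closedBall_zero_iff]
    rw [hn _ (hline hζ)]
    exact (mem_ball_zero_iff.mp (hline hζ)).le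
  have h1 : (1 : ℂ) ∈ ball (0 : ℂ) (1 / ‖z‖) := by
    rw [mem_ball_zero_iff, norm_one]
    exact (one_lt_div hzpos).mpr hz1
  have hds : dslope (fun ζ : ℂ => g (ζ • z)) 0 1 = g z := by
    rw [dslope_of_ne _ one_ne_zero, slope_def_module]
    simp [hg0]
  have : StrictConvexSpace ℝ E := by
    let _ : InnerProductSpace ℝ E := InnerProductSpace.rclikeToReal ℂ E
    infer_instance
  -- At `ζ = 1` the slope has norm `‖z‖ = 1 / (1 / ‖z‖)`, the extreme value in Schwarz's lemma, so
  -- the slice is affine. Strict convexity of the norm is what makes the equality case rigid.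
  have haff := Complex.affine_of_mapsTo_ball_of_norm_dslope_eq_div hd hm h1 (by
    rw [hds, hn z hz, one_div_one_div])
  rw [hds] at haff
  have hder1 : HasDerivAt (fun ζ : ℂ => g (ζ • z)) (fderiv ℂ g 0 z) 0 := by
    have e1 : HasFDerivAt g (fderiv ℂ g 0) ((0 : ℂ) • z) := by
      rw [zero_smul]
      exact (hg.differentiableAt (ball_mem_nhds _ one_pos)).hasFDerivAt
    have e2 : HasDerivAt (fun ζ : ℂ => ζ • z) z 0 := by
      simpa using (hasDerivAt_id (0 : ℂ)).smul_const z
    exact e1.comp_hasDerivAt 0 e2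
  have hder2 : HasDerivAt (fun ζ : ℂ => g (ζ • z)) (g z) 0 := by
    have e2 : HasDerivAt (fun ζ : ℂ => ζ • g z) (g z) 0 := by
      simpa using (hasDerivAt_id (0 : ℂ)).smul_const (g z)
    refine e2.congr_of_eventuallyEq ?_
    filter_upwards [ball_mem_nhds (0 : ℂ) (one_div_pos.mpr hzpos)] with ζ hζ
    simpa [hg0] using haff hζ
  exact hder2.unique hder1

theorem exists_linearIsometryEquiv_of_norm_eq [FiniteDimensional ℂ E] {g : E → E}
    (hg : DifferentiableOn ℂ g (ball 0 1)) (hn : ∀ z ∈ ball (0 : E) 1, ‖g z‖ = ‖z‖) :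
    ∃ U : E ≃ₗᵢ[ℂ] E, EqOn g U (ball 0 1) := by
  have hD : ∀ v, ‖fderiv ℂ g 0 v‖ = ‖v‖ := by
    intro v
    have hpos : 0 < 1 + ‖v‖ := by positivity
    -- Scaling by `1 / (1 + ‖v‖)` moves any `v` into the ball; homogeneity carries the isometry
    -- property back.
    have hmem : ((1 + ‖v‖ : ℝ) : ℂ)⁻¹ • v ∈ ball (0 : E) 1 := by
      rw [mem_ball_zero_iff, norm_smul, norm_inv, Complex.norm_real, Real.norm_eq_abs,
        abs_of_pos hpos, inv_mul_lt_iff₀ hpos]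
      linarith
    have h := hn _ hmem
    rw [eq_fderiv_apply_of_norm_eq hg hn hmem, map_smul, norm_smul, norm_smul] at h
    refine mul_left_cancel₀ ?_ h
    rw [norm_ne_zero_iff]
    exact inv_ne_zero (Complex.ofReal_ne_zero.mpr hpos.ne')
  let L : E →ₗᵢ[ℂ] E := ⟨(fderiv ℂ g 0).toLinearMap, hD⟩
  refine ⟨L.toLinearIsometryEquiv rfl, fun z hz => ?_⟩
  rw [eq_fderiv_apply_of_norm_eq hg hn hz]
  rfl

/-- If equality holds in Julia's lemma with source pole `p` and target pole `q` and factor one,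
then the map is norm-preserving. -/
theorem norm_eq_of_julia_eq {g : E → E} {p q : E} (hg : DifferentiableOn ℂ g (ball 0 1))
    (hm : MapsTo g (ball 0 1) (ball 0 1)) (hp : ‖p‖ = 1) (hq : ‖q‖ = 1) (hg0 : g 0 = 0)
    (h : ∀ z ∈ ball (0 : E) 1, (1 - ‖z‖ ^ 2) * ‖1 - inner ℂ q (g z)‖ ^ 2 =
      (1 - ‖g z‖ ^ 2) * ‖1 - inner ℂ p z‖ ^ 2) {z : E} (hz : z ∈ ball (0 : E) 1) :
    ‖g z‖ = ‖z‖ := by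
  have hne : ∀ z ∈ ball (0 : E) 1, 1 - inner ℂ q (g z) ≠ 0 := fun z hz =>
    one_sub_inner_ne_zero' hq.le (mem_ball_zero_iff.mp (hm hz))
  have hnep : ∀ z ∈ ball (0 : E) 1, 1 - inner ℂ p z ≠ 0 := fun z hz =>
    one_sub_inner_ne_zero' hp.le (mem_ball_zero_iff.mp hz)
  -- By hypothesis `‖k z‖² = (1 - ‖z‖²) / (1 - ‖g z‖²)`. Schwarz gives `‖k‖ ≤ 1` with equality at
  -- `0`, so the maximum principle yields `‖k‖ = 1` throughout.
  set k : E → ℂ := fun z => (1 - inner ℂ p z) / (1 - inner ℂ q (g z)) with hk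
  have hkd : DifferentiableOn ℂ k (ball 0 1) := by
    have h1 : DifferentiableOn ℂ (fun z => inner ℂ q (g z)) (ball 0 1) :=
      (innerSL ℂ q).differentiable.comp_differentiableOn hg
    have h2 : Differentiable ℂ (fun z => inner ℂ p z) := (innerSL ℂ p).differentiable
    simp only [hk, div_eq_mul_inv]
    exact DifferentiableOn.mul (by fun_prop) (DifferentiableOn.inv (by fun_prop) hne)
  have hk0 : ‖k 0‖ = 1 := by simp [hk, hg0]
  have hkle : ∀ z ∈ ball (0 : E) 1, ‖k z‖ ≤ 1 := by
    intro z hz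
    have hle := Complex.norm_le_norm_of_mapsTo_ball hg (hm.mono_right ball_subset_closedBall) hg0
      (mem_ball_zero_iff.mp hz)
    have hpos := one_sub_norm_sq_pos hz
    rw [hk, norm_div, div_le_one (norm_pos_iff.mpr (hne z hz))]
    refine le_of_sq_le_sq ?_ (norm_nonneg _)
    have hle2 : 1 - ‖z‖ ^ 2 ≤ 1 - ‖g z‖ ^ 2 := by gcongr
    refine le_of_mul_le_mul_left ?_ hpos
    rw [h z hz]
    gcongr
  have hmax : IsMaxOn (norm ∘ k) (ball 0 1) 0 := fun z hz => by
    simpa [hk0] using hkle z hz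
  have hkz := Complex.norm_eqOn_of_isPreconnected_of_isMaxOn
    (convex_ball (0 : E) 1).isPreconnected isOpen_ball hkd (mem_ball_self one_pos) hmax hz
  simp only [Function.comp_apply, Function.const_apply, hk0] at hkz
  rw [hk, norm_div, div_eq_one_iff_eq (norm_ne_zero_iff.mpr (hne z hz))] at hkz
  have hz2 := h z hz
  rw [← hkz] at hz2
  have h3 := mul_right_cancel₀ (pow_ne_zero 2 (norm_ne_zero_iff.mpr (hnep z hz))) hz2
  exact (pow_left_inj₀ (norm_nonneg _) (norm_nonneg _) two_ne_zero).mp (by linarith)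

/-- Applied with `w = f z` and `a = f 0`: the involution moves the target pole to `ballInvolution a
p` and normalizes the factor to one. -/
theorem one_sub_norm_sq_ballInvolution_eq {a p w z : E} (ha : ‖a‖ < 1) (hp : ‖p‖ = 1)
    (hw : ‖w‖ < 1) {lam : ℝ} (hlam : ‖1 - inner ℂ p a‖ ^ 2 = lam * (1 - ‖a‖ ^ 2))
    (h : (1 - ‖z‖ ^ 2) * ‖1 - inner ℂ p w‖ ^ 2 =
      lam * ((1 - ‖w‖ ^ 2) * ‖1 - inner ℂ p z‖ ^ 2)) :
    (1 - ‖z‖ ^ 2) * ‖1 - inner ℂ (ballInvolution a p) (ballInvolution a w)‖ ^ 2 =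
      (1 - ‖ballInvolution a w‖ ^ 2) * ‖1 - inner ℂ p z‖ ^ 2 := by
  have h1 := one_sub_inner_ne_zero ha hp.le
  have h2 := one_sub_inner_ne_zero ha hw.le
  have h3 := norm_pos_iff.mpr (one_sub_inner_ne_zero' hp.le ha)
  have h4 := norm_pos_iff.mpr h2
  have hpos : 0 < 1 - ‖a‖ ^ 2 := by nlinarith [norm_nonneg a]
  rw [one_sub_inner_ballInvolution ha h1 h2, one_sub_norm_sq_ballInvolution ha h2, norm_div,
    norm_mul, norm_mul, one_sub_inner_self, Complex.norm_real, Real.norm_eq_abs, abs_of_pos hpos]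
  have hlam0 : lam ≠ 0 := by
    rintro rfl
    rw [zero_mul] at hlam
    exact h3.ne' (pow_eq_zero_iff two_ne_zero |>.mp hlam)
  rw [div_pow, mul_pow, mul_pow, hlam]
  field_simp
  linear_combination h

/-- Equality in Julia's lemma forces a map of the ball to be biholomorphic. -/
theorem exists_inverse_of_julia_eq [FiniteDimensional ℂ E] {f : E → E} {p : E}
    (hf : DifferentiableOn ℂ f (ball 0 1)) (hm : MapsTo f (ball 0 1) (ball 0 1)) (hp : ‖p‖ = 1)
    {lam : ℝ} (h : ∀ z ∈ ball (0 : E) 1, (1 - ‖z‖ ^ 2) * ‖1 - inner ℂ p (f z)‖ ^ 2 =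
      lam * ((1 - ‖f z‖ ^ 2) * ‖1 - inner ℂ p z‖ ^ 2)) :
    ∃ g : E → E, DifferentiableOn ℂ g (ball 0 1) ∧ MapsTo g (ball 0 1) (ball 0 1) ∧
      InvOn g f (ball 0 1) (ball 0 1) := by
  have h0 : (0 : E) ∈ ball (0 : E) 1 := mem_ball_self one_pos
  have ha := mem_ball_zero_iff.mp (hm h0)
  -- Equality at `z = 0` determines the factor.
  have hlam : ‖1 - inner ℂ p (f 0)‖ ^ 2 = lam * (1 - ‖f 0‖ ^ 2) := by
    simpa using h 0 h0
  have hφ := differentiableOn_ballInvolution ha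
  have hφm := mapsTo_ballInvolution ha
  have hg : DifferentiableOn ℂ (ballInvolution (f 0) ∘ f) (ball 0 1) := hφ.comp hf hm
  obtain ⟨U, hU⟩ := exists_linearIsometryEquiv_of_norm_eq hg fun z hz =>
    norm_eq_of_julia_eq hg (hφm.comp hm) hp (norm_ballInvolution_of_norm_eq_one ha hp)
      (ballInvolution_self ha)
      (fun z hz => one_sub_norm_sq_ballInvolution_eq ha hp (mem_ball_zero_iff.mp (hm hz)) hlam
        (h z hz)) hz
  have hUm : ∀ V : E ≃ₗᵢ[ℂ] E, MapsTo V (ball 0 1) (ball 0 1) := fun V z hz => by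
    rw [mem_ball_zero_iff] at hz ⊢
    rwa [V.norm_map]
  have hinv := (invOn_ballInvolution ha).1
  refine ⟨U.symm ∘ ballInvolution (f 0), ?_, (hUm U.symm).comp hφm, fun z hz => ?_, fun z hz => ?_⟩
  · exact U.symm.toContinuousLinearEquiv.differentiable.comp_differentiableOn hφ
  · have := hU hz
    rw [Function.comp_apply] at this
    rw [Function.comp_apply, this, U.symm_apply_apply]
  · have hw := hUm U.symm (hφm hz)
    have := hU hw
    rw [Function.comp_apply, U.apply_symm_apply] at this
    rw [Function.comp_apply, ← hinv (hm hw), this, hinv hz]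

end Rigidity

/-! ### Eigenvalues of an operator whose adjoint has a known eigenvector. -/

section Eigenvalues

variable {E : Type*} [NormedAddCommGroup E] [InnerProductSpace ℂ E] [FiniteDimensional ℂ E]

/-- The range of `T - c` lies in `p^⊥`, so `T - c` is not surjective and, in finite dimension, not
injective. -/
theorem hasEigenvalue_of_inner_apply {T : Module.End ℂ E} {p : E} (hp : p ≠ 0) {c : ℂ}
    (hT : ∀ v, inner ℂ p (T v) = c * inner ℂ p v) : T.HasEigenvalue c := by
  rw [Module.End.hasEigenvalue_iff, Module.End.eigenspace_def]
  intro hker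
  have hsurj : Function.Surjective (T - algebraMap ℂ (Module.End ℂ E) c) :=
    LinearMap.injective_iff_surjective.mp (LinearMap.ker_eq_bot.mp hker)
  obtain ⟨v, hv⟩ := hsurj p
  have : inner ℂ p p = 0 := by
    nth_rewrite 2 [← hv]
    rw [LinearMap.sub_apply, Module.algebraMap_end_apply, inner_sub_right, hT, inner_smul_right,
      sub_self]
  exact hp (inner_self_eq_zero.mp this)

theorem exists_mem_ker_of_isNilpotent_on {V : Type*} [AddCommGroup V] [Module ℂ V]
    {N : Module.End ℂ V} {S : Submodule ℂ V} (hS : ∀ v ∈ S, N v ∈ S) :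
    ∀ (k : ℕ) (x : V), x ∈ S → x ≠ 0 → (N ^ k) x = 0 → ∃ y ∈ S, y ≠ 0 ∧ N y = 0 := by
  intro k
  induction k with
  | zero => intro x _ hx h; exact absurd h hx
  | succ k ih =>
    intro x hxS hx h
    by_cases hN : N x = 0
    · exact ⟨x, hxS, hx, hN⟩
    · exact ih (N x) (hS x hxS) hN (by rwa [pow_succ] at h)

/-- A generalized eigenspace of dimension at least two meets the hyperplane `p^⊥` nontrivially. As
`T - c` preserves `p^⊥`, the last nonzero iterate of such a vector is a true eigenvector there. -/
theorem exists_orthogonal_eigenvector_of_two_le {T : Module.End ℂ E} {p : E} {c : ℂ}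
    (hT : ∀ v, inner ℂ p (T v) = c * inner ℂ p v)
    (h2 : 2 ≤ T.charpoly.rootMultiplicity c) : ∃ x, x ≠ 0 ∧ inner ℂ p x = 0 ∧ T x = c • x := by
  rw [← LinearMap.finrank_maxGenEigenspace_eq] at h2
  have hker := LinearMap.ker_ne_bot_of_finrank_lt
    (f := (innerSL ℂ p).toLinearMap.domRestrict (T.maxGenEigenspace c))
    (by rw [Module.finrank_self]; omega)
  obtain ⟨⟨x, hxW⟩, hx, hx0⟩ := Submodule.exists_mem_ne_zero_of_ne_bot hker
  have hpx : inner ℂ p x = 0 := by simpa using hx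
  have hx0' : x ≠ 0 := fun h => hx0 (by simp [h])
  obtain ⟨k, hk⟩ := (Module.End.mem_maxGenEigenspace T c x).mp hxW
  obtain ⟨y, hy, hy0, hTy⟩ := exists_mem_ker_of_isNilpotent_on (N := T - c • 1)
    (S := LinearMap.ker (innerSL ℂ p).toLinearMap)
    (fun v hv => by
      have hv' : inner ℂ p v = 0 := by simpa using hv
      simp [inner_sub_right, hT, inner_smul_right, hv']) k x (by simpa using hpx) hx0' hk
  refine ⟨y, hy0, by simpa using hy, ?_⟩
  simpa [sub_eq_zero] using hTy

/-- If `p` is an eigenvector of the adjoint of `T` then the remaining eigenvalues of `T` have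
unit eigenvectors orthogonal to `p`. -/
theorem exists_roots_charpoly_eq_cons {T : Module.End ℂ E} {p : E} (hp : p ≠ 0) {c : ℂ}
    (hT : ∀ v, inner ℂ p (T v) = c * inner ℂ p v) :
    ∃ μ : Multiset ℂ, T.charpoly.roots = c ::ₘ μ ∧
      ∀ m ∈ μ, ∃ τ : E, ‖τ‖ = 1 ∧ inner ℂ p τ = 0 ∧ T τ = m • τ := by
  have hne : T.charpoly ≠ 0 := T.charpoly_monic.ne_zero
  have hc : c ∈ T.charpoly.roots := by
    rw [Polynomial.mem_roots hne, ← Module.End.hasEigenvalue_iff_isRoot_charpoly]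
    exact hasEigenvalue_of_inner_apply hp hT
  obtain ⟨μ, hμ⟩ := Multiset.exists_cons_of_mem hc
  refine ⟨μ, hμ, fun m hm => ?_⟩
  suffices h : ∃ x, x ≠ 0 ∧ inner ℂ p x = 0 ∧ T x = m • x by
    obtain ⟨x, hx, hpx, hTx⟩ := h
    refine ⟨(‖x‖⁻¹ : ℂ) • x, ?_, ?_, ?_⟩
    · simpa using norm_smul_inv_norm (𝕜 := ℂ) hx
    · rw [inner_smul_right, hpx, mul_zero]
    · rw [map_smul, hTx, smul_comm]
  -- If `c` recurs in `μ`, it has multiplicity at least two. Otherwise `⟨p, T x⟩ = c ⟨p, x⟩ = m ⟨p,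
  -- x⟩` forces every eigenvector to be orthogonal to `p`.
  rcases eq_or_ne m c with rfl | hmc
  · refine exists_orthogonal_eigenvector_of_two_le hT ?_
    rw [← Polynomial.count_roots, hμ, Multiset.count_cons_self]
    have := Multiset.one_le_count_iff_mem.mpr hm
    omega
  · have hm' : m ∈ T.charpoly.roots := by rw [hμ]; exact Multiset.mem_cons_of_mem hm
    rw [Polynomial.mem_roots hne, ← Module.End.hasEigenvalue_iff_isRoot_charpoly] at hm'
    obtain ⟨x, hx⟩ := hm'.exists_hasEigenvector
    refine ⟨x, hx.2, ?_, hx.apply_eq_smul⟩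
    have h := hT x
    rw [hx.apply_eq_smul, inner_smul_right] at h
    by_contra h0
    exact hmc (mul_right_cancel₀ h0 h)

end Eigenvalues

/-! ### Sums and products of bounded eigenvalues. -/

section Bounds

theorem norm_multiset_sum_le_card_mul {s : Multiset ℂ} {r : ℝ} (h : ∀ m ∈ s, ‖m‖ ≤ r) :
    ‖s.sum‖ ≤ s.card * r := by
  induction s using Multiset.induction_on with
  | empty => simp
  | cons a s ih =>
    rw [Multiset.sum_cons, Multiset.card_cons]
    have h1 := h a (Multiset.mem_cons_self a s)
    have h2 := ih fun m hm => h m (Multiset.mem_cons_of_mem hm)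
    push_cast
    linarith [norm_add_le a s.sum]

theorem norm_multiset_prod_le_pow_card {s : Multiset ℂ} {r : ℝ} (h : ∀ m ∈ s, ‖m‖ ≤ r) :
    ‖s.prod‖ ≤ r ^ s.card := by
  induction s using Multiset.induction_on with
  | empty => simp
  | cons a s ih =>
    rw [Multiset.prod_cons, Multiset.card_cons, norm_mul, pow_succ']
    have h1 := h a (Multiset.mem_cons_self a s)
    have h2 := ih fun m hm => h m (Multiset.mem_cons_of_mem hm)
    exact mul_le_mul h1 h2 (norm_nonneg _) ((norm_nonneg a).trans h1)

theorem mul_sqrt_pow_eq_rpow {lam : ℝ} (h : 0 < lam) {n : ℕ} (hn : 1 ≤ n) :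
    lam * Real.sqrt lam ^ (n - 1) = lam ^ (((n : ℝ) + 1) / 2) := by
  obtain ⟨k, rfl⟩ := Nat.exists_eq_add_of_le' hn
  rw [Nat.add_sub_cancel, Real.sqrt_eq_rpow, ← Real.rpow_natCast, ← Real.rpow_mul h.le]
  nth_rewrite 1 [← Real.rpow_one lam]
  rw [← Real.rpow_add h]
  congr 1
  push_cast
  ring

end Bounds

/-! ### From the Jacobian matrix to the Fréchet derivative. -/

section Jacobian

variable {n : ℕ}

theorem complexJacobian_eq_toMatrix (f : EuclideanSpace ℂ (Fin n) → EuclideanSpace ℂ (Fin n))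
    (z : EuclideanSpace ℂ (Fin n)) :
    complexJacobian f z = LinearMap.toMatrix (EuclideanSpace.basisFun (Fin n) ℂ).toBasis
      (EuclideanSpace.basisFun (Fin n) ℂ).toBasis (fderiv ℂ f z).toLinearMap := by
  ext j k
  simp [complexJacobian, LinearMap.toMatrix_apply]

theorem complexJacobian_mulVec (f : EuclideanSpace ℂ (Fin n) → EuclideanSpace ℂ (Fin n))
    (z v : EuclideanSpace ℂ (Fin n)) :
    (complexJacobian f z).mulVec v.ofLp = (fderiv ℂ f z v).ofLp := by
  have h := LinearMap.toMatrix_mulVec_repr (EuclideanSpace.basisFun (Fin n) ℂ).toBasis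
    (EuclideanSpace.basisFun (Fin n) ℂ).toBasis (fderiv ℂ f z).toLinearMap v
  have hr : ∀ v, ⇑((EuclideanSpace.basisFun (Fin n) ℂ).toBasis.repr v) = v.ofLp := fun v => by
    ext i
    simp
  rw [hr, hr] at h
  rw [complexJacobian_eq_toMatrix]
  exact h

theorem charpoly_complexJacobian (f : EuclideanSpace ℂ (Fin n) → EuclideanSpace ℂ (Fin n))
    (z : EuclideanSpace ℂ (Fin n)) :
    (complexJacobian f z).charpoly = (fderiv ℂ f z).toLinearMap.charpoly := by
  rw [complexJacobian_eq_toMatrix, LinearMap.charpoly_toMatrix]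

theorem complexJacobian_conjTranspose_mulVec
    (f : EuclideanSpace ℂ (Fin n) → EuclideanSpace ℂ (Fin n)) (z v : EuclideanSpace ℂ (Fin n)) :
    (complexJacobian f z).conjTranspose.mulVec v.ofLp =
      (ContinuousLinearMap.adjoint (fderiv ℂ f z) v).ofLp := by
  ext k
  have h := ContinuousLinearMap.adjoint_inner_right (fderiv ℂ f z) (EuclideanSpace.single k 1) v
  rw [EuclideanSpace.inner_single_left, map_one, one_mul] at h
  rw [h]
  simp [Matrix.mulVec, dotProduct, complexJacobian, PiLp.inner_apply, mul_comm]

end Jacobian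

/-! ### Extremal maps for the lower bound on `λ`. -/

section ChordMap

open Metric Set

variable {E : Type*} [NormedAddCommGroup E] [InnerProductSpace ℂ E]

/-- The coordinate on the complex line through `p` and `a` of the map `chordMap`. -/
noncomputable def chordCoord (w : ℂ) (B : ℝ) (ζ : ℂ) : ℂ :=
  w * (1 - ζ) / (w * (1 - ζ) + B * ζ)

/-- The map `z ↦ F ⟨z, p⟩`, where `F` parametrizes the disc cut out of the ball by the complex line
through `p` and `a` so that `F 0 = a` and `F 1 = p`. -/
noncomputable def chordMap (p a z : E) : E :=
  p + chordCoord (1 - inner ℂ a p) (1 - ‖a‖ ^ 2) (inner ℂ p z) • (a - p)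

theorem two_mul_re_one_sub_inner {p a : E} (hp : ‖p‖ = 1) :
    2 * (1 - inner ℂ p a).re = 1 - ‖a‖ ^ 2 + ‖a - p‖ ^ 2 := by
  rw [norm_sub_sq (𝕜 := ℂ), hp, inner_re_symm]
  simp only [RCLike.re_to_complex, Complex.sub_re, Complex.one_re]
  ring

/-- The denominator is `w - ζ (w - B)`, and `B ≤ 2 Re w` says exactly that `‖w - B‖ ≤ ‖w‖`. -/
theorem chordCoord_denom_ne_zero {w ζ : ℂ} {B : ℝ} (hB : 0 < B) (hw : B ≤ 2 * w.re)
    (hζ : ‖ζ‖ < 1) : w * (1 - ζ) + B * ζ ≠ 0 := by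
  intro h
  have h1 : w = ζ * (w - B) := by linear_combination h
  have hw0 : 0 < ‖w‖ := by
    rw [norm_pos_iff]
    rintro rfl
    simp at hw
    linarith
  have h2 : ‖w - B‖ ^ 2 ≤ ‖w‖ ^ 2 := by
    rw [Complex.sq_norm, Complex.sq_norm, Complex.normSq_apply, Complex.normSq_apply]
    simp only [Complex.sub_re, Complex.sub_im, Complex.ofReal_re, Complex.ofReal_im]
    nlinarith
  have h3 : ‖w - B‖ ≤ ‖w‖ := le_of_sq_le_sq h2 (norm_nonneg _)
  have h4 : ‖w‖ = ‖ζ‖ * ‖w - B‖ := by rw [← norm_mul, ← h1]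
  nlinarith [norm_nonneg ζ, norm_nonneg (w - B)]

/-- The factor `1 - ‖ζ‖²` shows that the unit disc is sent into the ball; here `v = a - p`, `w = 1 -
⟨a, p⟩` and `B = 1 - ‖a‖²`. -/
theorem norm_add_chordCoord_smul_sq {p v : E} (hp : ‖p‖ = 1) {w ζ : ℂ} {B : ℝ}
    (hw : inner ℂ v p = -w) (hv : ‖v‖ ^ 2 = 2 * w.re - B) (hd : w * (1 - ζ) + B * ζ ≠ 0) :
    1 - ‖p + chordCoord w B ζ • v‖ ^ 2 =
      ‖w‖ ^ 2 * B * (1 - ‖ζ‖ ^ 2) / ‖w * (1 - ζ) + B * ζ‖ ^ 2 := by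
  have hpv : inner ℂ p v = -(starRingEnd ℂ) w := by
    rw [← inner_conj_symm, hw, map_neg]
  have hn : 0 < ‖w * (1 - ζ) + B * ζ‖ := norm_pos_iff.mpr hd
  have hre : (chordCoord w B ζ * -(starRingEnd ℂ) w).re =
      -(‖w‖ ^ 2 * ((1 - ζ) * (starRingEnd ℂ) (w * (1 - ζ) + B * ζ)).re) /
        ‖w * (1 - ζ) + B * ζ‖ ^ 2 := by
    have hcd := Complex.mul_conj' (w * (1 - ζ) + B * ζ)
    have hcd0 : (starRingEnd ℂ) (w * (1 - ζ) + B * ζ) ≠ 0 := (map_ne_zero _).mpr hd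
    have : chordCoord w B ζ * -(starRingEnd ℂ) w =
        ((-(‖w‖ ^ 2) / ‖w * (1 - ζ) + B * ζ‖ ^ 2 : ℝ) : ℂ) *
          ((1 - ζ) * (starRingEnd ℂ) (w * (1 - ζ) + B * ζ)) := by
      push_cast
      rw [← hcd, ← Complex.mul_conj' w, chordCoord]
      generalize (starRingEnd ℂ) (w * (1 - ζ) + B * ζ) = d' at *
      generalize w * (1 - ζ) + B * ζ = d at *
      field_simp
    rw [this, Complex.re_ofReal_mul]
    ring
  rw [norm_add_sq (𝕜 := ℂ), inner_smul_right, hpv, RCLike.re_to_complex, hre, norm_smul, mul_pow,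
    hv, hp, chordCoord, norm_div, norm_mul, div_pow, mul_pow]
  field_simp
  simp only [Complex.sq_norm, Complex.normSq_apply, Complex.add_re, Complex.add_im, Complex.mul_re,
    Complex.mul_im, Complex.sub_re, Complex.sub_im, Complex.one_re, Complex.one_im,
    Complex.ofReal_re, Complex.ofReal_im, Complex.conj_re, Complex.conj_im]
  ring

theorem hasDerivAt_chordCoord_one {w : ℂ} {B : ℝ} (hB : B ≠ 0) :
    HasDerivAt (chordCoord w B) (-w / B) 1 := by
  have hB' : (B : ℂ) ≠ 0 := Complex.ofReal_ne_zero.mpr hB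
  have h1 : HasDerivAt (fun ζ : ℂ => w * (1 - ζ)) (-w) 1 := by
    simpa using ((hasDerivAt_id (1 : ℂ)).const_sub 1).const_mul w
  have h2 : HasDerivAt (fun ζ : ℂ => (B : ℂ) * ζ) B 1 := by
    simpa using (hasDerivAt_id (1 : ℂ)).const_mul (B : ℂ)
  have h := h1.fun_div (h1.fun_add h2) (by simpa using hB')
  have e : (-w * (w * (1 - 1) + B * 1) - w * (1 - 1) * (-w + B)) / (w * (1 - 1) + B * 1) ^ 2 =
      -w / (B : ℂ) := by
    rw [sub_self, mul_zero, mul_one, zero_mul, zero_add, sub_zero]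
    field_simp
  rwa [e] at h

theorem chordMap_zero (p : E) {a : E} (hp : ‖p‖ = 1) (ha : ‖a‖ < 1) : chordMap p a 0 = a := by
  have := one_sub_inner_ne_zero ha hp.le
  simp [chordMap, chordCoord, this]

theorem chordMap_self {p : E} (a : E) (hp : ‖p‖ = 1) : chordMap p a p = p := by
  simp [chordMap, chordCoord, inner_self_eq_norm_sq_to_K, hp]

theorem hasFDerivAt_chordMap {p a : E} (hp : ‖p‖ = 1) (ha : ‖a‖ < 1) :
    HasFDerivAt (chordMap p a)
      (((-(1 - inner ℂ a p) / ((1 - ‖a‖ ^ 2 : ℝ) : ℂ)) • innerSL ℂ p).smulRight (a - p)) p := by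
  have hB : 1 - ‖a‖ ^ 2 ≠ 0 := by nlinarith [norm_nonneg a]
  have hpp : innerSL ℂ p p = 1 := by simp [inner_self_eq_norm_sq_to_K, hp]
  have h1 : HasDerivAt (chordCoord (1 - inner ℂ a p) (1 - ‖a‖ ^ 2))
      (-(1 - inner ℂ a p) / ((1 - ‖a‖ ^ 2 : ℝ) : ℂ)) (innerSL ℂ p p) := by
    rw [hpp]
    exact hasDerivAt_chordCoord_one hB
  exact ((h1.comp_hasFDerivAt p (innerSL ℂ p).hasFDerivAt).smul_const (a - p)).const_add p

theorem analyticAt_chordMap {p a : E} (hp : ‖p‖ = 1) (ha : ‖a‖ < 1) :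
    AnalyticAt ℂ (chordMap p a) p := by
  have hB : ((1 - ‖a‖ ^ 2 : ℝ) : ℂ) ≠ 0 :=
    Complex.ofReal_ne_zero.mpr (by nlinarith [norm_nonneg a])
  have hpp : inner ℂ p p = 1 := by simp [inner_self_eq_norm_sq_to_K, hp]
  have hi : AnalyticAt ℂ (fun z : E => inner ℂ p z) p := (innerSL ℂ p).analyticAt p
  unfold chordMap chordCoord
  refine analyticAt_const.add (AnalyticAt.smul (AnalyticAt.div ?_ ?_ ?_) analyticAt_const)
  · fun_prop
  · fun_prop
  · rw [hpp]
    simpa using hB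

theorem one_sub_norm_sq_chordMap_pos {p a z : E} (hp : ‖p‖ = 1) (ha : ‖a‖ < 1) (hz : ‖z‖ < 1) :
    (1 - inner ℂ a p) * (1 - inner ℂ p z) + ((1 - ‖a‖ ^ 2 : ℝ) : ℂ) * inner ℂ p z ≠ 0 ∧
      0 < 1 - ‖chordMap p a z‖ ^ 2 := by
  have hB : 0 < 1 - ‖a‖ ^ 2 := by nlinarith [norm_nonneg a]
  have hre : 2 * (1 - inner ℂ a p).re = 1 - ‖a‖ ^ 2 + ‖a - p‖ ^ 2 := by
    rw [← two_mul_re_one_sub_inner hp, Complex.sub_re, Complex.sub_re, ← inner_conj_symm a p,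
      Complex.conj_re]
  have hζ : ‖inner ℂ p z‖ < 1 := by
    refine (norm_inner_le_norm _ _).trans_lt ?_
    rwa [hp, one_mul]
  have hd := chordCoord_denom_ne_zero hB (w := 1 - inner ℂ a p) (by nlinarith) hζ
  refine ⟨hd, ?_⟩
  rw [chordMap, norm_add_chordCoord_smul_sq hp
    (by rw [inner_sub_left, inner_self_eq_norm_sq_to_K, hp]; simp) (by linarith) hd]
  have h1 := norm_pos_iff.mpr hd
  have h2 := norm_pos_iff.mpr (one_sub_inner_ne_zero ha hp.le)
  have h3 : 0 < 1 - ‖inner ℂ p z‖ ^ 2 := by nlinarith [norm_nonneg (inner ℂ p z)]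
  positivity

theorem mapsTo_chordMap {p a : E} (hp : ‖p‖ = 1) (ha : ‖a‖ < 1) :
    MapsTo (chordMap p a) (ball 0 1) (ball 0 1) := by
  intro z hz
  rw [mem_ball_zero_iff] at hz ⊢
  have := (one_sub_norm_sq_chordMap_pos hp ha hz).2
  nlinarith [norm_nonneg (chordMap p a z)]

theorem differentiableOn_chordMap {p a : E} (hp : ‖p‖ = 1) (ha : ‖a‖ < 1) :
    DifferentiableOn ℂ (chordMap p a) (ball 0 1) := by
  have hi : Differentiable ℂ (fun z : E => inner ℂ p z) := (innerSL ℂ p).differentiable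
  unfold chordMap chordCoord
  simp only [div_eq_mul_inv]
  refine DifferentiableOn.const_add _ (DifferentiableOn.smul_const (DifferentiableOn.mul
    (by fun_prop) (DifferentiableOn.inv (by fun_prop) fun z hz => ?_)) _)
  exact (one_sub_norm_sq_chordMap_pos hp ha (mem_ball_zero_iff.mp hz)).1

end ChordMap

/-! ### Hyperbolic automorphisms, extremal for the other eigenvalues. -/

section Dilation

open Metric Set

variable {E : Type*} [NormedAddCommGroup E] [InnerProductSpace ℂ E]

/-- The denominator of the hyperbolic dilation. -/
noncomputable def ballDilationDenom (s : ℝ) (p z : E) : ℂ :=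
  (1 + inner ℂ p z) + s ^ 2 * (1 - inner ℂ p z)

/-- The hyperbolic automorphism of the ball with fixed points `p` and `-p` whose derivative
at `p` has the eigenvalue `s ^ 2` on `p` and `s` on the complex tangent space. -/
noncomputable def ballDilation (s : ℝ) (p z : E) : E :=
  -- On the coordinate `ζ = ⟨p, z⟩` this is the disc map `ζ ↦ ζ'` with `(1 - ζ') / (1 + ζ') = s² (1
  -- - ζ) / (1 + ζ)`.
  (ballDilationDenom s p z)⁻¹ • ((2 * s : ℂ) • (z - (inner ℂ p z) • p) +
    ((1 + inner ℂ p z) - s ^ 2 * (1 - inner ℂ p z)) • p)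

theorem ballDilationDenom_ne_zero {s : ℝ} (hs : 0 < s) {p z : E} (hp : ‖p‖ = 1) (hz : ‖z‖ < 1) :
    ballDilationDenom s p z ≠ 0 := by
  have hζ : ‖inner ℂ p z‖ < 1 := by
    refine (norm_inner_le_norm _ _).trans_lt ?_
    rwa [hp, one_mul]
  have h1 := (abs_le.mp ((Complex.abs_re_le_norm (inner ℂ p z)).trans hζ.le))
  have h2 := (abs_lt.mp ((Complex.abs_re_le_norm (inner ℂ p z)).trans_lt hζ))
  intro h
  have hre := congrArg Complex.re h
  rw [ballDilationDenom, ← Complex.ofReal_pow, Complex.add_re, Complex.re_ofReal_mul] at hre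
  simp only [Complex.add_re, Complex.sub_re, Complex.one_re, Complex.zero_re] at hre
  have : 0 < s ^ 2 * (1 - (inner ℂ p z).re) := mul_pos (by positivity) (by linarith)
  linarith

theorem one_sub_norm_sq_ballDilation {s : ℝ} {p z : E} (hp : ‖p‖ = 1)
    (hd : ballDilationDenom s p z ≠ 0) :
    1 - ‖ballDilation s p z‖ ^ 2 = 4 * s ^ 2 * (1 - ‖z‖ ^ 2) / ‖ballDilationDenom s p z‖ ^ 2 := by
  have hpp : inner ℂ p p = 1 := by simp [inner_self_eq_norm_sq_to_K, hp]
  have horth : inner ℂ (z - (inner ℂ p z) • p) p = 0 := by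
    rw [inner_sub_left, inner_smul_left, hpp, mul_one, inner_conj_symm, sub_self]
  have hz : ‖z - (inner ℂ p z) • p‖ ^ 2 = ‖z‖ ^ 2 - ‖inner ℂ p z‖ ^ 2 := by
    have h := norm_add_sq (𝕜 := ℂ) (z - (inner ℂ p z) • p) ((inner ℂ p z) • p)
    rw [sub_add_cancel, inner_smul_right, horth, norm_smul, hp] at h
    simp only [mul_zero, map_zero, add_zero, mul_one] at h
    linarith
  have hn := norm_pos_iff.mpr hd
  rw [ballDilation, norm_smul, norm_inv, mul_pow, norm_add_sq (𝕜 := ℂ), inner_smul_left,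
    inner_smul_right, horth, norm_smul, norm_smul, hp, mul_pow, hz]
  simp only [mul_zero, map_zero, add_zero, mul_one]
  field_simp
  simp only [ballDilationDenom]
  simp only [← Complex.ofReal_pow, Complex.sq_norm, Complex.normSq_apply, Complex.add_re,
    Complex.add_im, Complex.mul_re,
    Complex.mul_im, Complex.sub_re, Complex.sub_im, Complex.one_re, Complex.one_im,
    Complex.ofReal_re, Complex.ofReal_im, Complex.re_ofNat, Complex.im_ofNat]
  ring

theorem mapsTo_ballDilation {s : ℝ} (hs : 0 < s) {p : E} (hp : ‖p‖ = 1) :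
    MapsTo (ballDilation s p) (ball 0 1) (ball 0 1) := by
  intro z hz
  have hpos := one_sub_norm_sq_pos hz
  rw [mem_ball_zero_iff] at hz ⊢
  have hd := ballDilationDenom_ne_zero hs hp hz
  have h := one_sub_norm_sq_ballDilation hp hd
  have hn := norm_pos_iff.mpr hd
  have : 0 < 4 * s ^ 2 * (1 - ‖z‖ ^ 2) / ‖ballDilationDenom s p z‖ ^ 2 := by positivity
  nlinarith [norm_nonneg (ballDilation s p z)]

theorem differentiableOn_ballDilation {s : ℝ} (hs : 0 < s) {p : E} (hp : ‖p‖ = 1) :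
    DifferentiableOn ℂ (ballDilation s p) (ball 0 1) := by
  have hi : Differentiable ℂ (fun z : E => inner ℂ p z) := (innerSL ℂ p).differentiable
  have hd : Differentiable ℂ (ballDilationDenom s p) := by unfold ballDilationDenom; fun_prop
  unfold ballDilation
  refine DifferentiableOn.smul (DifferentiableOn.inv (by fun_prop) fun z hz =>
    ballDilationDenom_ne_zero hs hp (mem_ball_zero_iff.mp hz)) ?_
  fun_prop

theorem ballDilationDenom_self (s : ℝ) {p : E} (hp : ‖p‖ = 1) : ballDilationDenom s p p = 2 := by
  have hpp : inner ℂ p p = 1 := by simp [inner_self_eq_norm_sq_to_K, hp]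
  rw [ballDilationDenom, hpp]
  ring

theorem ballDilation_self (s : ℝ) {p : E} (hp : ‖p‖ = 1) : ballDilation s p p = p := by
  have hpp : inner ℂ p p = 1 := by simp [inner_self_eq_norm_sq_to_K, hp]
  rw [ballDilation, ballDilationDenom_self s hp, hpp]
  module

theorem analyticAt_ballDilation (s : ℝ) {p : E} (hp : ‖p‖ = 1) :
    AnalyticAt ℂ (ballDilation s p) p := by
  have hi : AnalyticAt ℂ (fun z : E => inner ℂ p z) p := (innerSL ℂ p).analyticAt p
  have hd : AnalyticAt ℂ (ballDilationDenom s p) p := by unfold ballDilationDenom; fun_prop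
  unfold ballDilation
  refine AnalyticAt.smul (hd.inv ?_) ?_
  · rw [ballDilationDenom_self s hp]
    exact two_ne_zero
  · fun_prop

theorem fderiv_ballDilation_apply (s : ℝ) {p : E} (hp : ‖p‖ = 1) (v : E) :
    fderiv ℂ (ballDilation s p) p v = (s : ℂ) • v + ((s ^ 2 - s : ℂ) * inner ℂ p v) • p := by
  have hpp : inner ℂ p p = 1 := by simp [inner_self_eq_norm_sq_to_K, hp]
  have hD := (analyticAt_ballDilation s hp).differentiableAt.hasFDerivAt
  have hline : ∀ w : E, HasDerivAt (fun ζ : ℂ => p + ζ • w) w 0 := fun w => by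
    simpa using ((hasDerivAt_id (0 : ℂ)).smul_const w).const_add p
  have h1 : HasDerivAt (fun ζ : ℂ => ballDilation s p (p + ζ • v))
      (fderiv ℂ (ballDilation s p) p v) 0 := by
    have hD' : HasFDerivAt (ballDilation s p) (fderiv ℂ (ballDilation s p) p)
        (p + (0 : ℂ) • v) := by
      simpa only [zero_smul, add_zero] using hD
    exact hD'.comp_hasDerivAt 0 (hline v)
  set c : ℂ := inner ℂ p v with hc
  have hden : HasDerivAt (fun ζ : ℂ => 2 + ζ * ((1 - s ^ 2) * c)) ((1 - s ^ 2) * c) 0 := by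
    simpa using ((hasDerivAt_id (0 : ℂ)).mul_const ((1 - s ^ 2) * c)).const_add 2
  have hnum : HasDerivAt (fun ζ : ℂ => (2 : ℂ) • p + ζ • ((2 * s : ℂ) • (v - c • p) +
      ((1 + s ^ 2) * c) • p)) ((2 * s : ℂ) • (v - c • p) + ((1 + s ^ 2) * c) • p) 0 := by
    generalize (2 * s : ℂ) • (v - c • p) + ((1 + s ^ 2) * c) • p = u
    simpa using ((hasDerivAt_id (0 : ℂ)).smul_const u).const_add ((2 : ℂ) • p)
  have h2 := (hden.fun_inv (by simp)).fun_smul hnum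
  -- On a line through `p` the dilation is an affine vector function over an affine scalar one.
  have heq : (fun ζ : ℂ => ballDilation s p (p + ζ • v)) = fun ζ : ℂ =>
      (2 + ζ * ((1 - s ^ 2) * c))⁻¹ • ((2 : ℂ) • p + ζ • ((2 * s : ℂ) • (v - c • p) +
      ((1 + s ^ 2) * c) • p)) := by
    funext ζ
    rw [ballDilation, ballDilationDenom, inner_add_right, inner_smul_right, hpp, ← hc]
    congr 1
    · congr 1
      ring
    · module
  rw [← heq] at h2
  rw [h1.unique h2]
  simp only [zero_mul, add_zero, zero_smul]
  module

end Dilation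

/-! ### Assembly of the bounds and of the extremal examples. -/

section Main

open Metric Set

variable {n : ℕ}

theorem julia_eq_iff_kernel_eq {p z w : EuclideanSpace ℂ (Fin n)} (hp : ‖p‖ = 1)
    (hz : z ∈ unitBall n) (hw : w ∈ unitBall n) (lam : ℝ) :
    lam * pluricomplexPoissonKernel p w = pluricomplexPoissonKernel p z ↔
      (1 - ‖z‖ ^ 2) * ‖1 - inner ℂ p w‖ ^ 2 =
        lam * ((1 - ‖w‖ ^ 2) * ‖1 - inner ℂ p z‖ ^ 2) := by
  have h1 := norm_pos_iff.mpr (one_sub_inner_ne_zero' hp.le (mem_ball_zero_iff.mp hz))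
  have h2 := norm_pos_iff.mpr (one_sub_inner_ne_zero' hp.le (mem_ball_zero_iff.mp hw))
  rw [pluricomplexPoissonKernel, pluricomplexPoissonKernel, mul_neg, neg_inj, ← mul_div_assoc,
    div_eq_div_iff (by positivity) (by positivity), mul_assoc, eq_comm]

theorem julia_le_iff_kernel_le {p z w : EuclideanSpace ℂ (Fin n)} (hp : ‖p‖ = 1)
    (hz : z ∈ unitBall n) (hw : w ∈ unitBall n) (lam : ℝ) :
    lam * pluricomplexPoissonKernel p w ≤ pluricomplexPoissonKernel p z ↔
      (1 - ‖z‖ ^ 2) * ‖1 - inner ℂ p w‖ ^ 2 ≤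
        lam * ((1 - ‖w‖ ^ 2) * ‖1 - inner ℂ p z‖ ^ 2) := by
  have h1 := norm_pos_iff.mpr (one_sub_inner_ne_zero' hp.le (mem_ball_zero_iff.mp hz))
  have h2 := norm_pos_iff.mpr (one_sub_inner_ne_zero' hp.le (mem_ball_zero_iff.mp hw))
  rw [pluricomplexPoissonKernel, pluricomplexPoissonKernel, mul_neg, neg_le_neg_iff,
    ← mul_div_assoc, div_le_div_iff₀ (by positivity) (by positivity), mul_assoc]

theorem card_of_roots_charpoly_eq_cons {A : Matrix (Fin n) (Fin n) ℂ} {c : ℂ} {μ : Multiset ℂ}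
    (h : A.charpoly.roots = c ::ₘ μ) : n = μ.card + 1 := by
  have h1 := IsAlgClosed.card_roots_eq_natDegree (p := A.charpoly)
  rw [h, Matrix.charpoly_natDegree_eq_dim, Fintype.card_fin, Multiset.card_cons] at h1
  exact h1.symm

theorem ballSelfMapFixing_properties {p : EuclideanSpace ℂ (Fin n)} (hp : ‖p‖ = 1)
    {f : EuclideanSpace ℂ (Fin n) → EuclideanSpace ℂ (Fin n)} (hf : IsBallSelfMapFixing p f) :
    ∃ (lam : ℝ) (μ : Multiset ℂ),
        (complexJacobian f p).charpoly.roots = (lam : ℂ) ::ₘ μ ∧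
        HasLineDerivAt ℝ (fun z => ‖f z‖) lam p p ∧
        ‖1 - inner ℂ p (f 0)‖ ^ 2 / (1 - ‖f 0‖ ^ 2) ≤ lam ∧
        0 < ‖1 - inner ℂ p (f 0)‖ ^ 2 / (1 - ‖f 0‖ ^ 2) ∧
        Matrix.mulVec (complexJacobian f p).conjTranspose p.ofLp = (lam : ℂ) • p.ofLp ∧
        (∀ m ∈ μ, ‖m‖ ≤ Real.sqrt lam) ∧
        (∀ m ∈ μ, ∃ τ : EuclideanSpace ℂ (Fin n), ‖τ‖ = 1 ∧ τ ∈ complexTangentSpace p ∧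
          Matrix.mulVec (complexJacobian f p) τ.ofLp = m • τ.ofLp) ∧
        ‖(complexJacobian f p).det‖ ≤ lam ^ (((n : ℝ) + 1) / 2) ∧
        ‖(complexJacobian f p).trace‖ ≤ lam + ((n : ℝ) - 1) * Real.sqrt lam ∧
        (∀ z ∈ unitBall n,
          lam * pluricomplexPoissonKernel p (f z) ≤ pluricomplexPoissonKernel p z) ∧
        ((∀ z ∈ unitBall n,
          lam * pluricomplexPoissonKernel p (f z) = pluricomplexPoissonKernel p z) ↔
            IsBallAutomorphism f ∧ f p = p) := by
  obtain ⟨hd, hm, hfa, hfp⟩ := hf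
  have hD := hfa.differentiableAt.hasFDerivAt
  have hp0 : p ≠ 0 := by
    rintro rfl
    simp at hp
  have hadj := adjoint_fderiv_apply_fixedPoint hm hp hfp hD
  -- This one number is the directional derivative, the distinguished eigenvalue and the factor in
  -- Julia's lemma.
  set lam := (inner ℂ p (fderiv ℂ f p p)).re with hlam
  have hT : ∀ v, inner ℂ p ((fderiv ℂ f p).toLinearMap v) = (lam : ℂ) * inner ℂ p v := by
    intro v
    rw [ContinuousLinearMap.coe_coe, ← ContinuousLinearMap.adjoint_inner_left, hadj,
      inner_smul_left, Complex.conj_ofReal]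
  obtain ⟨μ, hμ, hτ⟩ := exists_roots_charpoly_eq_cons hp0 hT
  rw [← charpoly_complexJacobian] at hμ
  have h0 : (0 : EuclideanSpace ℂ (Fin n)) ∈ unitBall n := mem_ball_self one_pos
  have hpos0 := one_sub_norm_sq_pos (hm h0)
  have hne0 := norm_pos_iff.mpr (one_sub_inner_ne_zero' hp.le (mem_ball_zero_iff.mp (hm h0)))
  have hi : ‖1 - inner ℂ p (f 0)‖ ^ 2 / (1 - ‖f 0‖ ^ 2) ≤ lam := by
    have h := julia_ball hd hm hp hfp hD h0
    rw [div_le_iff₀ hpos0]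
    simpa using h
  have hipos : 0 < ‖1 - inner ℂ p (f 0)‖ ^ 2 / (1 - ‖f 0‖ ^ 2) := by positivity
  have hlpos : 0 < lam := hipos.trans_le hi
  have hμle : ∀ m ∈ μ, ‖m‖ ≤ Real.sqrt lam := by
    intro m hmμ
    obtain ⟨τ, hτ1, hτp, hτm⟩ := hτ m hmμ
    have h := norm_fderiv_apply_sq_le hd hm hp hfp hfa hτ1 hτp
    rw [ContinuousLinearMap.coe_coe] at hτm
    rw [hτm, norm_smul, hτ1, mul_one] at h
    exact Real.le_sqrt_of_sq_le h
  have hcard := card_of_roots_charpoly_eq_cons hμ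
  refine ⟨lam, μ, hμ, hasLineDerivAt_norm hp hfp hD, hi, hipos, ?_, hμle, ?_, ?_, ?_, ?_, ?_⟩
  · rw [complexJacobian_conjTranspose_mulVec, hadj]
    rfl
  · intro m hmμ
    obtain ⟨τ, hτ1, hτp, hτm⟩ := hτ m hmμ
    refine ⟨τ, hτ1, Submodule.mem_orthogonal_singleton_iff_inner_right.mpr hτp, ?_⟩
    rw [ContinuousLinearMap.coe_coe] at hτm
    rw [complexJacobian_mulVec, hτm]
    rfl
  · rw [Matrix.det_eq_prod_roots_charpoly, hμ, Multiset.prod_cons, norm_mul, Complex.norm_real,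
      Real.norm_eq_abs, abs_of_pos hlpos, ← mul_sqrt_pow_eq_rpow hlpos (by omega)]
    gcongr
    have h := norm_multiset_prod_le_pow_card hμle
    rwa [show μ.card = n - 1 by omega] at h
  · rw [Matrix.trace_eq_sum_roots_charpoly, hμ, Multiset.sum_cons]
    refine (norm_add_le _ _).trans ?_
    rw [Complex.norm_real, Real.norm_eq_abs, abs_of_pos hlpos]
    have h := norm_multiset_sum_le_card_mul hμle
    have hn : (n : ℝ) - 1 = μ.card := by rw [hcard]; push_cast; ring
    rw [hn]
    linarith
  · intro z hz
    rw [julia_le_iff_kernel_le hp hz (hm hz)]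
    exact julia_ball hd hm hp hfp hD hz
  · constructor
    · intro h
      exact ⟨⟨hd, hm, exists_inverse_of_julia_eq hd hm hp fun z hz =>
        (julia_eq_iff_kernel_eq hp hz (hm hz) lam).mp (h z hz)⟩, hfp⟩
    · rintro ⟨⟨_, _, g, hg, hgm, hgf⟩, _⟩ z hz
      rw [julia_eq_iff_kernel_eq hp hz (hm hz)]
      exact julia_ball_eq_of_inverse hd hm hg hgm hgf.1 hp hfp hD hz

theorem isBallSelfMapFixing_chordMap {p a : EuclideanSpace ℂ (Fin n)} (hp : ‖p‖ = 1)
    (ha : ‖a‖ < 1) : IsBallSelfMapFixing p (chordMap p a) :=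
  ⟨differentiableOn_chordMap hp ha, mapsTo_chordMap hp ha, analyticAt_chordMap hp ha,
    chordMap_self a hp⟩

theorem hasLineDerivAt_norm_chordMap {p a : EuclideanSpace ℂ (Fin n)} (hp : ‖p‖ = 1)
    (ha : ‖a‖ < 1) : HasLineDerivAt ℝ (fun z => ‖chordMap p a z‖)
      (‖1 - inner ℂ p a‖ ^ 2 / (1 - ‖a‖ ^ 2)) p p := by
  have h := hasLineDerivAt_norm hp (chordMap_self a hp) (hasFDerivAt_chordMap hp ha)
  have hpp : inner ℂ p p = 1 := by simp [inner_self_eq_norm_sq_to_K, hp]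
  have e : (starRingEnd ℂ) (1 - inner ℂ p a) = 1 - inner ℂ a p := by
    rw [map_sub, map_one, inner_conj_symm]
  have e2 : -(1 - inner ℂ a p) / ((1 - ‖a‖ ^ 2 : ℝ) : ℂ) * (inner ℂ p a - 1) =
      ((‖1 - inner ℂ p a‖ ^ 2 / (1 - ‖a‖ ^ 2) : ℝ) : ℂ) := by
    rw [Complex.ofReal_div, Complex.ofReal_pow, ← Complex.mul_conj', e]
    ring
  rw [ContinuousLinearMap.smulRight_apply, smul_apply, innerSL_apply_apply, hpp,
    inner_smul_right, inner_sub_right, hpp, smul_eq_mul, mul_one, e2, Complex.ofReal_re] at h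
  exact h

theorem isBallSelfMapFixing_ballDilation {p : EuclideanSpace ℂ (Fin n)} (hp : ‖p‖ = 1) {s : ℝ}
    (hs : 0 < s) : IsBallSelfMapFixing p (ballDilation s p) :=
  ⟨differentiableOn_ballDilation hs hp, mapsTo_ballDilation hs hp, analyticAt_ballDilation s hp,
    ballDilation_self s hp⟩

theorem inner_fderiv_ballDilation {p : EuclideanSpace ℂ (Fin n)} (hp : ‖p‖ = 1) (s : ℝ)
    (v : EuclideanSpace ℂ (Fin n)) :
    inner ℂ p (fderiv ℂ (ballDilation s p) p v) = ((s ^ 2 : ℝ) : ℂ) * inner ℂ p v := by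
  have hpp : inner ℂ p p = 1 := by simp [inner_self_eq_norm_sq_to_K, hp]
  rw [fderiv_ballDilation_apply s hp, inner_add_right, inner_smul_right, inner_smul_right, hpp]
  push_cast
  ring

theorem hasLineDerivAt_norm_ballDilation {p : EuclideanSpace ℂ (Fin n)} (hp : ‖p‖ = 1) (s : ℝ) :
    HasLineDerivAt ℝ (fun z => ‖ballDilation s p z‖) (s ^ 2) p p := by
  have h := hasLineDerivAt_norm hp (ballDilation_self s hp)
    (analyticAt_ballDilation s hp).differentiableAt.hasFDerivAt
  have hpp : inner ℂ p p = 1 := by simp [inner_self_eq_norm_sq_to_K, hp]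
  rwa [inner_fderiv_ballDilation hp, hpp, mul_one, Complex.ofReal_re] at h

/-- The remaining eigenvalues have eigenvectors in `p^⊥`, where the derivative is multiplication by
`s`. -/
theorem roots_charpoly_ballDilation {p : EuclideanSpace ℂ (Fin n)} (hp : ‖p‖ = 1) (s : ℝ) :
    (complexJacobian (ballDilation s p) p).charpoly.roots =
      ((s ^ 2 : ℝ) : ℂ) ::ₘ Multiset.replicate (n - 1) (s : ℂ) := by
  have hp0 : p ≠ 0 := by
    rintro rfl
    simp at hp
  obtain ⟨μ, hμ, hτ⟩ := exists_roots_charpoly_eq_cons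
    (T := (fderiv ℂ (ballDilation s p) p).toLinearMap) hp0 (inner_fderiv_ballDilation hp s)
  rw [← charpoly_complexJacobian] at hμ
  have hcard := card_of_roots_charpoly_eq_cons hμ
  rw [hμ]
  congr 1
  rw [Multiset.eq_replicate]
  refine ⟨by omega, fun m hm => ?_⟩
  obtain ⟨τ, hτ1, hτp, hτm⟩ := hτ m hm
  rw [ContinuousLinearMap.coe_coe, fderiv_ballDilation_apply s hp, hτp, mul_zero, zero_smul,
    add_zero] at hτm
  have hτ0 : τ ≠ 0 := by
    rintro rfl
    simp at hτ1
  exact (smul_left_injective ℂ hτ0 hτm).symm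

end Main

theorem mainTheorem3 (n : ℕ) (p : EuclideanSpace ℂ (Fin n)) (hp : ‖p‖ = 1) :
    -- the statements (i)-(vi); `μ` is the multiset of the eigenvalues `μ₂, …, μₙ`
    (∀ f : EuclideanSpace ℂ (Fin n) → EuclideanSpace ℂ (Fin n), IsBallSelfMapFixing p f →
      ∃ (lam : ℝ) (μ : Multiset ℂ),
        (complexJacobian f p).charpoly.roots = (lam : ℂ) ::ₘ μ ∧
        HasLineDerivAt ℝ (fun z => ‖f z‖) lam p p ∧
        ‖1 - inner ℂ p (f 0)‖ ^ 2 / (1 - ‖f 0‖ ^ 2) ≤ lam ∧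
        0 < ‖1 - inner ℂ p (f 0)‖ ^ 2 / (1 - ‖f 0‖ ^ 2) ∧
        Matrix.mulVec (complexJacobian f p).conjTranspose p.ofLp = (lam : ℂ) • p.ofLp ∧
        (∀ m ∈ μ, ‖m‖ ≤ Real.sqrt lam) ∧
        (∀ m ∈ μ, ∃ τ : EuclideanSpace ℂ (Fin n), ‖τ‖ = 1 ∧ τ ∈ complexTangentSpace p ∧
          Matrix.mulVec (complexJacobian f p) τ.ofLp = m • τ.ofLp) ∧
        ‖(complexJacobian f p).det‖ ≤ lam ^ (((n : ℝ) + 1) / 2) ∧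
        ‖(complexJacobian f p).trace‖ ≤ lam + ((n : ℝ) - 1) * Real.sqrt lam ∧
        (∀ z ∈ unitBall n,
          lam * pluricomplexPoissonKernel p (f z) ≤ pluricomplexPoissonKernel p z) ∧
        ((∀ z ∈ unitBall n,
          lam * pluricomplexPoissonKernel p (f z) = pluricomplexPoissonKernel p z) ↔
            IsBallAutomorphism f ∧ f p = p)) ∧
    -- sharpness of (i), for every prescribed value of `f 0`
    (∀ a ∈ unitBall n, ∃ f : EuclideanSpace ℂ (Fin n) → EuclideanSpace ℂ (Fin n),
      IsBallSelfMapFixing p f ∧ f 0 = a ∧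
        HasLineDerivAt ℝ (fun z => ‖f z‖)
          (‖1 - inner ℂ p (f 0)‖ ^ 2 / (1 - ‖f 0‖ ^ 2)) p p) ∧
    -- sharpness of (iii) and (v), for every prescribed value of `λ`
    (∀ lam : ℝ, 0 < lam → ∃ (f : EuclideanSpace ℂ (Fin n) → EuclideanSpace ℂ (Fin n))
      (μ : Multiset ℂ), IsBallSelfMapFixing p f ∧
        HasLineDerivAt ℝ (fun z => ‖f z‖) lam p p ∧
        (complexJacobian f p).charpoly.roots = (lam : ℂ) ::ₘ μ ∧
        (∀ m ∈ μ, ‖m‖ = Real.sqrt lam) ∧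
        ‖(complexJacobian f p).det‖ = lam ^ (((n : ℝ) + 1) / 2) ∧
        ‖(complexJacobian f p).trace‖ = lam + ((n : ℝ) - 1) * Real.sqrt lam) := by
  refine ⟨fun f hf => ballSelfMapFixing_properties hp hf, fun a ha => ?_, fun lam hlam => ?_⟩
  · have ha' := mem_ball_zero_iff.mp ha
    refine ⟨chordMap p a, isBallSelfMapFixing_chordMap hp ha', chordMap_zero p hp ha', ?_⟩
    rw [chordMap_zero p hp ha']
    exact hasLineDerivAt_norm_chordMap hp ha'
  · have hs := Real.sqrt_pos.mpr hlam
    have hs2 := Real.sq_sqrt hlam.le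
    have hroots := roots_charpoly_ballDilation hp (Real.sqrt lam)
    have hline := hasLineDerivAt_norm_ballDilation hp (Real.sqrt lam)
    rw [hs2] at hroots hline
    -- The characteristic polynomial has a root, so its degree `n` is positive; this makes the
    -- truncated `n - 1` harmless.
    have hn : 1 ≤ n := by
      have := card_of_roots_charpoly_eq_cons hroots
      omega
    refine ⟨ballDilation (Real.sqrt lam) p, _, isBallSelfMapFixing_ballDilation hp hs, hline,
      hroots, fun m hm => ?_, ?_, ?_⟩
    · rw [Multiset.eq_of_mem_replicate hm, Complex.norm_real, Real.norm_eq_abs, abs_of_pos hs]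
    · rw [Matrix.det_eq_prod_roots_charpoly, hroots, Multiset.prod_cons, Multiset.prod_replicate,
        norm_mul, norm_pow, Complex.norm_real, Complex.norm_real, Real.norm_eq_abs,
        Real.norm_eq_abs, abs_of_pos hlam, abs_of_pos hs, mul_sqrt_pow_eq_rpow hlam hn]
    · rw [Matrix.trace_eq_sum_roots_charpoly, hroots, Multiset.sum_cons, Multiset.sum_replicate,
        nsmul_eq_mul, ← Complex.ofReal_natCast, ← Complex.ofReal_mul, ← Complex.ofReal_add,
        Complex.norm_real, Real.norm_eq_abs, Nat.cast_sub hn, Nat.cast_one, abs_of_nonneg]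
      have : (1 : ℝ) ≤ n := by exact_mod_cast hn
      exact add_nonneg hlam.le (mul_nonneg (by linarith) hs.le)
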